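/- For $n\in\mathbb N_0=\{0,1,2,\dots\}$ let $A_n=(-2^{-n-1},2^{-n-1})$, and for $\lambda\in\mathbb R^2$ and $n_1,n_2\in\mathbb N_0$ let $R^\lambda_{n_1,n_2}=\lambda+A_{n_1}\times A_{n_2}$. Let $\mathcal F$ be the Fourier transform on $L^2(\mathbb R^2)$. There is an absolute constant $C>0$ with the following property. Let $Q_1,Q_2\ge 1$ be integers and let $\Lambda\subset Q_1^{-1}\mathbb Z\times Q_2^{-1}\mathbb Z$ be a finite set such that $\max\{|\lambda_1-\lambda_1'|,|\lambda_2-\lambda_2'|\}\ge 1$ for all distinct $\lambda,\lambda'\in\Lambda$. If $Q_1\sqrt{|\Lambda|}>e$ and $Q_2\sqrt{|\Lambda|}>e$, then for all $f\in L^2(\mathbb R^2)$ $$\Big\|\sup_{n_1,n_2\in\mathbb N_0}\Big|\sum_{\lambda\in\Lambda}\mathcal F^{-1}\big(\mathbf 1_{R^\lambda_{n_1,n_2}}\mathcal Ff\big)\Big|\Big\|_{L^2}\le C\,\log\log\big(Q_1\sqrt{|\Lambda|}\big)\cdot\log\log\big(Q_2\sqrt{|\Lambda|}\big)\,\|f\|_{L^2}.$$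 Moreover, without the last two conditions, the same inequality holds for all $f\in L^2(\mathbb R^2)$ if each factor $\log\log(Q_i\sqrt{|\Lambda|})$ is replaced by $1$ whenever it is less than $1$ or undefined. -/

import Mathlib

open MeasureTheory
open scoped FourierTransform ENNReal

namespace TwoParam

/-- The Euclidean plane `ℝ²`, with Lebesgue measure `volume`. -/
abbrev Plane : Type := EuclideanSpace ℝ (Fin 2)

/-- The Hilbert space `L²(ℝ²)` of complex-valued functions. -/
abbrev L2 : Type := Lp (α := Plane) ℂ 2 volume

/-- The interval `Aₙ = (-2^{-n-1}, 2^{-n-1})`. -/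
def dyadicInterval (n : ℕ) : Set ℝ :=
  Set.Ioo (-((2 : ℝ) ^ (n + 1))⁻¹) (((2 : ℝ) ^ (n + 1))⁻¹)

/-- The rectangle `λ + A_{n₁} × A_{n₂}`. -/
def rect (l : Plane) (n₁ n₂ : ℕ) : Set Plane :=
  {ξ | ξ 0 - l 0 ∈ dyadicInterval n₁ ∧ ξ 1 - l 1 ∈ dyadicInterval n₂}

theorem measurableSet_rect (l : Plane) (n₁ n₂ : ℕ) : MeasurableSet (rect l n₁ n₂) := by
  have h : ∀ i : Fin 2, Measurable fun ξ : Plane => ξ i - l i := fun i => by fun_prop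
  exact (h 0 measurableSet_Ioo).inter (h 1 measurableSet_Ioo)

/-- Multiplication of an `L²` function by the indicator function of a measurable set. -/
noncomputable def cutoff {S : Set Plane} (hS : MeasurableSet S) (g : L2) : L2 :=
  (MemLp.indicator hS (Lp.memLp g)).toLp (S.indicator g)

/-- The operator `f ↦ ∑_{λ ∈ Λ} ℱ⁻¹(1_{λ + A_{n₁} × A_{n₂}} ℱ f)` on `L²(ℝ²)`. -/
noncomputable def freqProj (Lam : Finset Plane) (n₁ n₂ : ℕ) (f : L2) : L2 :=
  ∑ l ∈ Lam, 𝓕⁻ (cutoff (measurableSet_rect l n₁ n₂) (𝓕 f))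

/-- The two-parameter maximal function `x ↦ sup_{n₁, n₂} |∑_{λ ∈ Λ} ℱ⁻¹(1 ℱ f)(x)|`,
with values in `[0, ∞]`. -/
noncomputable def maximalFn (Lam : Finset Plane) (f : L2) (x : Plane) : ℝ≥0∞ :=
  ⨆ (n₁ : ℕ) (n₂ : ℕ), ‖freqProj Lam n₁ n₂ f x‖ₑ

/-- `Λ ⊂ Q₁⁻¹ℤ × Q₂⁻¹ℤ`. -/
def InGrid (Q₁ Q₂ : ℕ) (Lam : Finset Plane) : Prop :=
  ∀ l ∈ Lam, ∃ a b : ℤ, l 0 = (a : ℝ) / (Q₁ : ℝ) ∧ l 1 = (b : ℝ) / (Q₂ : ℝ)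

/-- Distinct points of `Λ` are at distance at least one in the max norm. -/
def Separated (Lam : Finset Plane) : Prop :=
  ∀ l ∈ Lam, ∀ l' ∈ Lam, l ≠ l' → 1 ≤ max |l 0 - l' 0| |l 1 - l' 1|

end TwoParam

namespace TwoParam

/-! Separation makes the unit squares around the points of `Λ` disjoint, so the total symbol factors
as `ind (U n₁) * ind (V n₂)`, where `U n` and `V n` are the unions of the rectangles shrunk in one
coordinate only (`Separated.sum_ind_rect`). Each factor is a one-parameter nested family whose local
centres lie in `Q⁻¹ℤ` (`IsNested`). The two parameters are decoupled by `TensorBound`: such a family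
multiplies the maximal bound of an arbitrary second family by a constant, so the two one-parameter
constants multiply.

For one factor, choose `2 ^ L` comparable to `Q`. The scales `n ≤ L` are handled by
Rademacher–Menshov at a cost of about `log L`, that is `log log Q` (`tensorBound_ind_min`). At the
scales `n = L + m` all centres look alike to symbols of period `1/Q` in the relevant coordinate: the
average over `2 ^ m` translations by `Q` along that axis is such a symbol, and on `U L` it differs
from the sharp cutoff by a square-summable error (`tensorBound_ind_sub_avg`). These averages are
positive operators, controlled by an `L²` maximal inequality on translation orbits
(`lintegral_iSup_orbitAvg_sq_le`), which is proved by linearising the supremum and bootstrapping a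
`TT*` estimate.

The resulting bound involves only `log log Q₁` and `log log Q₂`; `|Λ|` enters only through `Q ≤ Q *
√|Λ|` for nonempty `Λ`. -/

/-! ### Cauchy–Schwarz inequalities and measurable linearisation of a maximum -/

/-- The Cauchy–Schwarz inequality for lower integrals, with squares. -/
theorem sq_lintegral_mul_le {α : Type*} [MeasurableSpace α] {ν : Measure α} {f g : α → ℝ≥0∞}
    (hf : Measurable f) (hg : Measurable g) :
    (∫⁻ x, f x * g x ∂ν) ^ 2 ≤ (∫⁻ x, f x ^ 2 ∂ν) * ∫⁻ x, g x ^ 2 ∂ν := by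
  have h := ENNReal.lintegral_mul_le_Lp_mul_Lq ν (p := 2) (q := 2)
    (by constructor <;> norm_num) hf.aemeasurable hg.aemeasurable
  have h2 := pow_le_pow_left₀ (zero_le) h 2
  rw [mul_pow, ← ENNReal.rpow_natCast, ← ENNReal.rpow_natCast (_ ^ (_ : ℝ)),
    ← ENNReal.rpow_natCast (_ ^ (_ : ℝ)), ← ENNReal.rpow_mul, ← ENNReal.rpow_mul] at h2
  norm_num at h2
  simpa using h2

/-- The Cauchy–Schwarz inequality for finite sums in `[0, ∞]`, with squares. -/
theorem sq_sum_le_card_mul {ι : Type*} (s : Finset ι) (a : ι → ℝ≥0∞) :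
    (∑ i ∈ s, a i) ^ 2 ≤ s.card * ∑ i ∈ s, a i ^ 2 := by
  have h := ENNReal.rpow_sum_le_const_mul_sum_rpow s a (p := 2) (by norm_num)
  norm_num at h
  exact h

theorem measurable_finset_sup {α ι : Type*} [MeasurableSpace α] (s : Finset ι)
    {b : ι → α → ℝ≥0∞} (hb : ∀ j, Measurable (b j)) :
    Measurable fun x => s.sup fun j => b j x := by
  simp_rw [Finset.sup_eq_iSup]
  exact Measurable.biSup (s : Set ι) s.countable_toSet fun j _ => hb j

/-- A measurable choice of the scale at which a finite maximum is attained. -/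
theorem exists_measurable_partition_sup {α : Type*} [MeasurableSpace α] (J : ℕ)
    {b : ℕ → α → ℝ≥0∞} (hb : ∀ j, Measurable (b j)) :
    ∃ h : ℕ → α → ℝ≥0∞, (∀ j, Measurable (h j)) ∧
      (∀ x, ∑ j ∈ Finset.range (J + 1), h j x = (Finset.range (J + 1)).sup fun j => b j x) ∧
      ∀ x, ∑ j ∈ Finset.range (J + 1), h j x * b j x =
        ((Finset.range (J + 1)).sup fun j => b j x) ^ 2 := by
  classical
  set M : α → ℝ≥0∞ := fun x => (Finset.range (J + 1)).sup fun j => b j x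
  have hM : Measurable M := measurable_finset_sup _ hb
  -- `X j` is the set where `j` is the first index attaining the maximum, so these sets partition
  -- the space.
  let X : ℕ → Set α := fun j => {x | b j x = M x} ∩ ⋂ i ∈ Finset.range j, {x | b i x = M x}ᶜ
  have hX : ∀ j, MeasurableSet (X j) := fun j =>
    (measurableSet_eq_fun (hb j) hM).inter
      (Finset.measurableSet_biInter _ fun i _ => (measurableSet_eq_fun (hb i) hM).compl)
  have hsel : ∀ x, ∃ j ∈ Finset.range (J + 1), b j x = M x ∧ ∀ i, x ∈ X i ↔ i = j := by
    intro x
    have hex : ∃ j, b j x = M x := by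
      obtain ⟨j, hj, h⟩ := Finset.exists_mem_eq_sup (Finset.range (J + 1)) (by simp)
        fun j => b j x
      exact ⟨j, h.symm⟩
    refine ⟨Nat.find hex, ?_, Nat.find_spec hex, ?_⟩
    · obtain ⟨j, hj, h⟩ := Finset.exists_mem_eq_sup (Finset.range (J + 1)) (by simp)
        fun j => b j x
      have := Nat.find_min' hex h.symm
      rw [Finset.mem_range] at hj ⊢
      omega
    · intro i
      simp only [X, Set.mem_inter_iff, Set.mem_ofPred_eq, Set.mem_iInter, Finset.mem_range,
        Set.mem_compl_iff]
      rw [eq_comm (a := i), Nat.find_eq_iff]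
  refine ⟨fun j => (X j).indicator M, fun j => hM.indicator (hX j), ?_, ?_⟩
  · intro x
    obtain ⟨j, hj, -, h⟩ := hsel x
    rw [Finset.sum_eq_single_of_mem j hj]
    · exact Set.indicator_of_mem ((h j).2 rfl) _
    · intro i _ hij
      exact Set.indicator_of_notMem (fun hi => hij ((h i).1 hi)) _
  · intro x
    obtain ⟨j, hj, hjM, h⟩ := hsel x
    rw [Finset.sum_eq_single_of_mem j hj]
    · dsimp only
      rw [Set.indicator_of_mem ((h j).2 rfl), hjM, sq]
    · intro i _ hij
      dsimp only
      rw [Set.indicator_of_notMem (fun hi => hij ((h i).1 hi)), zero_mul]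

/-! ### The `L²` maximal inequality for averages along a translation orbit -/

section OrbitAverages

variable {E : Type*} [AddCommGroup E]

/-- Averages over the two-sided orbit `x - 2^j v, …, x + 2^j v`, normalised by `2^j`. -/
noncomputable def orbitAvg (v : E) (j : ℕ) (g : E → ℝ≥0∞) (x : E) : ℝ≥0∞ :=
  ((2 : ℝ≥0∞) ^ j)⁻¹ * ∑ k ∈ Finset.Icc (-(2 ^ j : ℤ)) (2 ^ j), g (x + k • v)

theorem orbitAvg_mono (v : E) (j : ℕ) {g h : E → ℝ≥0∞} (hgh : ∀ x, g x ≤ h x) (x : E) :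
    orbitAvg v j g x ≤ orbitAvg v j h x := by
  unfold orbitAvg
  gcongr
  exact hgh _

theorem orbitAvg_sum (v : E) (j : ℕ) {ι : Type*} (s : Finset ι) (g : ι → E → ℝ≥0∞) (x : E) :
    orbitAvg v j (fun y => ∑ i ∈ s, g i y) x = ∑ i ∈ s, orbitAvg v j (g i) x := by
  unfold orbitAvg
  rw [Finset.sum_comm, Finset.mul_sum]

theorem card_Icc_neg_two_pow (j : ℕ) :
    (Finset.Icc (-(2 ^ j : ℤ)) (2 ^ j)).card = 2 * 2 ^ j + 1 := by
  rw [Int.card_Icc]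
  have : ((2 ^ j : ℕ) : ℤ) = 2 ^ j := by push_cast; rfl
  omega

theorem inv_two_pow_mul_card_le (j : ℕ) :
    ((2 : ℝ≥0∞) ^ j)⁻¹ * ((Finset.Icc (-(2 ^ j : ℤ)) (2 ^ j)).card : ℝ≥0∞) ≤ 3 := by
  rw [card_Icc_neg_two_pow, mul_comm, ← div_eq_mul_inv]
  refine ENNReal.div_le_of_le_mul ?_
  have : 2 * 2 ^ j + 1 ≤ 3 * 2 ^ j := by have := Nat.one_le_two_pow (n := j); omega
  exact_mod_cast this

/-- Shifting a window of radius `2 ^ j` by at most `2 ^ i ≤ 2 ^ j` keeps it inside the window of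
radius `2 ^ (j + 1)`. The factor 6 is 3 for the mass of the outer average times 2 for the change of
normalisation. -/
theorem orbitAvg_orbitAvg_le (v : E) {i j : ℕ} (hij : i ≤ j) (g : E → ℝ≥0∞) (x : E) :
    orbitAvg v i (orbitAvg v j g) x ≤ 6 * orbitAvg v (j + 1) g x := by
  have h1 : ∀ k ∈ Finset.Icc (-(2 ^ i : ℤ)) (2 ^ i),
      orbitAvg v j g (x + k • v) ≤ 2 * orbitAvg v (j + 1) g x := by
    intro k hk
    have hk' := Finset.mem_Icc.1 hk
    have hpow : (2 : ℤ) ^ i ≤ 2 ^ j := pow_le_pow_right₀ (by norm_num) hij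
    have hsum : ∑ l ∈ Finset.Icc (-(2 ^ j : ℤ)) (2 ^ j), g (x + k • v + l • v) ≤
        ∑ l ∈ Finset.Icc (-(2 ^ (j + 1) : ℤ)) (2 ^ (j + 1)), g (x + l • v) := by
      have : ∑ l ∈ Finset.Icc (-(2 ^ j : ℤ)) (2 ^ j), g (x + k • v + l • v) =
          ∑ l ∈ (Finset.Icc (-(2 ^ j : ℤ)) (2 ^ j)).image (fun l => k + l), g (x + l • v) := by
        rw [Finset.sum_image (by intro a _ b _ h; simpa using h)]
        simp [add_assoc, add_smul]
      rw [this]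
      refine Finset.sum_le_sum_of_subset ?_
      intro l hl
      obtain ⟨a, ha, rfl⟩ := Finset.mem_image.1 hl
      have ha' := Finset.mem_Icc.1 ha
      rw [Finset.mem_Icc, pow_succ]
      constructor <;> omega
    have h2 : ((2 : ℝ≥0∞) ^ j)⁻¹ = 2 * ((2 : ℝ≥0∞) ^ (j + 1))⁻¹ := by
      rw [pow_succ, ENNReal.mul_inv (by simp) (by simp), mul_left_comm,
        ENNReal.mul_inv_cancel (by simp) (by simp), mul_one]
    unfold orbitAvg
    rw [h2, mul_assoc]
    gcongr
  calc orbitAvg v i (orbitAvg v j g) x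
      ≤ ((2 : ℝ≥0∞) ^ i)⁻¹ * ∑ k ∈ Finset.Icc (-(2 ^ i : ℤ)) (2 ^ i),
          2 * orbitAvg v (j + 1) g x := by
        rw [orbitAvg]; gcongr with k hk; exact h1 k hk
    _ = (((2 : ℝ≥0∞) ^ i)⁻¹ * ((Finset.Icc (-(2 ^ i : ℤ)) (2 ^ i)).card : ℝ≥0∞)) *
          (2 * orbitAvg v (j + 1) g x) := by
        rw [Finset.sum_const, nsmul_eq_mul, mul_assoc]
    _ ≤ 3 * (2 * orbitAvg v (j + 1) g x) := by gcongr; exact inv_two_pow_mul_card_le i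
    _ = 6 * orbitAvg v (j + 1) g x := by rw [← mul_assoc]; norm_num

/-- The maximal function of the first `J + 1` orbit averages. -/
noncomputable def orbitMax (v : E) (J : ℕ) (g : E → ℝ≥0∞) (x : E) : ℝ≥0∞ :=
  (Finset.range (J + 1)).sup fun j => orbitAvg v j g x

variable [MeasurableSpace E] [MeasurableAdd E] {μ : Measure E} [μ.IsAddRightInvariant]

theorem measurable_orbitAvg (v : E) (j : ℕ) {g : E → ℝ≥0∞} (hg : Measurable g) :
    Measurable (orbitAvg v j g) := by
  unfold orbitAvg
  refine Measurable.const_mul ?_ _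
  exact Finset.measurable_sum _ fun k _ => hg.comp (measurable_add_const _)

/-- The averages are self-adjoint because the window is symmetric and the measure is translation
invariant. -/
theorem lintegral_orbitAvg_mul (v : E) (j : ℕ) {g h : E → ℝ≥0∞} (hg : Measurable g)
    (hh : Measurable h) :
    ∫⁻ x, orbitAvg v j g x * h x ∂μ = ∫⁻ x, g x * orbitAvg v j h x ∂μ := by
  have key : ∀ k : ℤ, ∫⁻ x, g (x + k • v) * h x ∂μ = ∫⁻ x, g x * h (x + (-k) • v) ∂μ := by
    intro k
    rw [← lintegral_add_right_eq_self (fun x => g x * h (x + (-k) • v)) (k • v)]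
    simp [add_assoc]
  have hgm : ∀ k : ℤ, Measurable fun x => g (x + k • v) :=
    fun k => hg.comp (measurable_add_const _)
  have hhm : ∀ k : ℤ, Measurable fun x => h (x + k • v) :=
    fun k => hh.comp (measurable_add_const _)
  have h1 : ∀ x, orbitAvg v j g x * h x =
      ((2 : ℝ≥0∞) ^ j)⁻¹ * ∑ k ∈ Finset.Icc (-(2 ^ j : ℤ)) (2 ^ j), g (x + k • v) * h x := by
    intro x; rw [orbitAvg, mul_assoc, Finset.sum_mul]
  have h2 : ∀ x, g x * orbitAvg v j h x =
      ((2 : ℝ≥0∞) ^ j)⁻¹ * ∑ k ∈ Finset.Icc (-(2 ^ j : ℤ)) (2 ^ j), g x * h (x + k • v) := by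
    intro x; rw [orbitAvg, mul_left_comm, Finset.mul_sum]
  simp_rw [h1, h2]
  rw [lintegral_const_mul _ (Finset.measurable_sum _ fun k _ => (hgm k).fun_mul hh),
    lintegral_const_mul _ (Finset.measurable_sum _ fun k _ => hg.fun_mul (hhm k)),
    lintegral_finsetSum _ (fun k _ => (hgm k).fun_mul hh),
    lintegral_finsetSum _ (fun k _ => hg.fun_mul (hhm k))]
  congr 1
  simp_rw [key]
  refine Finset.sum_nbij' (fun k => -k) (fun k => -k) ?_ ?_ ?_ ?_ ?_ <;>
    simp +contextual [neg_le]

theorem lintegral_orbitAvg_sq_le (v : E) (j : ℕ) {g : E → ℝ≥0∞} (hg : Measurable g) :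
    ∫⁻ x, orbitAvg v j g x ^ 2 ∂μ ≤ 9 * ∫⁻ x, g x ^ 2 ∂μ := by
  set s := Finset.Icc (-(2 ^ j : ℤ)) (2 ^ j)
  set a : ℝ≥0∞ := ((2 : ℝ≥0∞) ^ j)⁻¹
  have hm : ∀ k : ℤ, Measurable fun x => g (x + k • v) ^ 2 :=
    fun k => (hg.comp (measurable_add_const _)).pow_const 2
  calc ∫⁻ x, orbitAvg v j g x ^ 2 ∂μ
      ≤ ∫⁻ x, (a ^ 2 * s.card) * ∑ k ∈ s, g (x + k • v) ^ 2 ∂μ := by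
        refine lintegral_mono fun x => ?_
        rw [orbitAvg, mul_pow, mul_assoc]
        gcongr
        exact sq_sum_le_card_mul _ _
    _ = (a ^ 2 * s.card) * (s.card * ∫⁻ x, g x ^ 2 ∂μ) := by
        rw [lintegral_const_mul _ (Finset.measurable_sum _ fun k _ => hm k),
          lintegral_finsetSum _ fun k _ => hm k]
        simp_rw [lintegral_add_right_eq_self (fun x => g x ^ 2)]
        rw [Finset.sum_const, nsmul_eq_mul]
    _ = (a * s.card) * (a * s.card) * ∫⁻ x, g x ^ 2 ∂μ := by ring
    _ ≤ 3 * 3 * ∫⁻ x, g x ^ 2 ∂μ := by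
        gcongr <;> exact inv_two_pow_mul_card_le j
    _ = 9 * ∫⁻ x, g x ^ 2 ∂μ := by norm_num

theorem measurable_orbitMax (v : E) (J : ℕ) {g : E → ℝ≥0∞} (hg : Measurable g) :
    Measurable (orbitMax v J g) := by
  exact measurable_finset_sup _ fun j => measurable_orbitAvg v j hg

/-- This crude bound, growing with `J`, starts the bootstrap and also supplies the finiteness needed
to cancel a factor in it. -/
theorem lintegral_orbitMax_sq_le_card (v : E) (J : ℕ) {g : E → ℝ≥0∞} (hg : Measurable g) :
    ∫⁻ x, orbitMax v J g x ^ 2 ∂μ ≤ 9 * (J + 1 : ℕ) * ∫⁻ x, g x ^ 2 ∂μ := by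
  calc ∫⁻ x, orbitMax v J g x ^ 2 ∂μ
      ≤ ∫⁻ x, ∑ j ∈ Finset.range (J + 1), orbitAvg v j g x ^ 2 ∂μ := by
        refine lintegral_mono fun x => ?_
        obtain ⟨j, hj, h⟩ := Finset.exists_mem_eq_sup (Finset.range (J + 1)) (by simp)
          fun j => orbitAvg v j g x
        rw [orbitMax, h]
        exact Finset.single_le_sum (f := fun j => orbitAvg v j g x ^ 2)
          (fun _ _ => zero_le) hj
    _ = ∑ j ∈ Finset.range (J + 1), ∫⁻ x, orbitAvg v j g x ^ 2 ∂μ :=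
        lintegral_finsetSum _ fun j _ => (measurable_orbitAvg v j hg).pow_const 2
    _ ≤ ∑ j ∈ Finset.range (J + 1), 9 * ∫⁻ x, g x ^ 2 ∂μ :=
        Finset.sum_le_sum fun j _ => lintegral_orbitAvg_sq_le v j hg
    _ = 9 * (J + 1 : ℕ) * ∫⁻ x, g x ^ 2 ∂μ := by
        rw [Finset.sum_const, nsmul_eq_mul, Finset.card_range]; ring

/-- The self-improving step in the `TT*` argument for the orbit maximal function. -/
theorem lintegral_orbitMax_sq_le_of_succ (v : E) (J : ℕ) (y : ℝ≥0∞) (hy : y ≠ 0)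
    (H : ∀ g : E → ℝ≥0∞, Measurable g →
      ∫⁻ x, orbitMax v (J + 1) g x ^ 2 ∂μ ≤ (12 * y) ^ 2 * ∫⁻ x, g x ^ 2 ∂μ)
    {g : E → ℝ≥0∞} (hg : Measurable g) :
    ∫⁻ x, orbitMax v J g x ^ 2 ∂μ ≤ 144 * y * ∫⁻ x, g x ^ 2 ∂μ := by
  obtain ⟨h, hhm, hsum, hmul⟩ := exists_measurable_partition_sup J
    (b := fun j => orbitAvg v j g) fun j => measurable_orbitAvg v j hg
  change ∀ x, ∑ j ∈ Finset.range (J + 1), h j x = orbitMax v J g x at hsum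
  change ∀ x, ∑ j ∈ Finset.range (J + 1), h j x * orbitAvg v j g x = orbitMax v J g x ^ 2 at hmul
  set s := Finset.range (J + 1)
  set F := orbitMax v J g
  have hF : Measurable F := measurable_orbitMax v J hg
  set a := ∫⁻ x, F x ^ 2 ∂μ with ha_def
  set b := ∫⁻ x, g x ^ 2 ∂μ with hb_def
  by_cases hbtop : b = ∞
  · rw [hbtop, ENNReal.mul_top (by simp [hy])]; exact le_top
  have hatop : a ≠ ∞ := ne_top_of_le_ne_top
    (ENNReal.mul_ne_top (by finiteness) hbtop) (lintegral_orbitMax_sq_le_card (μ := μ) v J hg)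
  by_cases ha0 : a = 0
  · rw [ha0]; exact zero_le
  have havg : ∀ i j, Measurable (orbitAvg v i (h j)) := fun i j => measurable_orbitAvg v i (hhm j)
  set w : E → ℝ≥0∞ := fun x => ∑ j ∈ s, orbitAvg v j (h j) x with hw_def
  have hw : Measurable w := Finset.measurable_sum _ fun j _ => havg j j
  -- Duality: `w` is the adjoint of the linearised maximal operator applied to the selected pieces
  -- `h j` of `F`.
  have hagw : a = ∫⁻ x, g x * w x ∂μ := by
    have e1 : a = ∫⁻ x, ∑ j ∈ s, orbitAvg v j g x * h j x ∂μ := by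
      rw [ha_def]; refine lintegral_congr fun x => ?_
      rw [← hmul x]; exact Finset.sum_congr rfl fun j _ => mul_comm _ _
    rw [e1, lintegral_finsetSum _ fun j _ => (measurable_orbitAvg v j hg).fun_mul (hhm j)]
    simp_rw [hw_def, Finset.mul_sum]
    rw [lintegral_finsetSum _ fun j _ => hg.fun_mul (havg j j)]
    exact Finset.sum_congr rfl fun j _ => lintegral_orbitAvg_mul v j hg (hhm j)
  have hCS : a ^ 2 ≤ b * ∫⁻ x, w x ^ 2 ∂μ := by
    rw [hagw]; exact sq_lintegral_mul_le hg hw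
  set F' := orbitMax v (J + 1) F
  have hF' : Measurable F' := measurable_orbitMax v (J + 1) hF
  set d : ℕ → ℕ → ℝ≥0∞ := fun i j => 6 * ∫⁻ x, orbitAvg v (j + 1) (h i) x * h j x ∂μ with hd
  have hcle : ∀ i j, i ≤ j → ∫⁻ x, orbitAvg v i (h i) x * orbitAvg v j (h j) x ∂μ ≤ d i j := by
    intro i j hij
    rw [lintegral_orbitAvg_mul v i (hhm i) (havg j j), hd]
    dsimp only
    rw [lintegral_orbitAvg_mul v (j + 1) (hhm i) (hhm j),
      ← lintegral_const_mul _ ((hhm i).fun_mul (havg (j + 1) j))]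
    refine lintegral_mono fun x => ?_
    rw [mul_left_comm]
    gcongr
    exact orbitAvg_orbitAvg_le v hij _ _
  have hcle' : ∀ i j, ∫⁻ x, orbitAvg v i (h i) x * orbitAvg v j (h j) x ∂μ ≤ d i j + d j i := by
    intro i j
    rcases le_total i j with hij | hij
    · exact (hcle i j hij).trans le_self_add
    · simp_rw [mul_comm (orbitAvg v i (h i) _)]
      exact (hcle j i hij).trans le_add_self
  -- The pieces `h i` add up to `F`, so summing over `i` leaves averages of `F` itself; these are
  -- bounded by the maximal function one scale longer, to which `H` applies.
  have hdsum : ∑ j ∈ s, ∑ i ∈ s, d i j ≤ 6 * ∫⁻ x, F x * F' x ∂μ := by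
    have e1 : ∀ j ∈ s, ∑ i ∈ s, d i j ≤ 6 * ∫⁻ x, F' x * h j x ∂μ := by
      intro j hj
      rw [hd]; dsimp only
      rw [← Finset.mul_sum, ← lintegral_finsetSum _ fun i _ => (havg (j + 1) i).fun_mul (hhm j)]
      gcongr with x
      rw [← Finset.sum_mul, ← orbitAvg_sum]
      gcongr
      simp_rw [hsum]
      exact Finset.le_sup (f := fun j => orbitAvg v j F x)
        (by simp only [s, Finset.mem_range] at hj ⊢; omega)
    refine (Finset.sum_le_sum e1).trans ?_
    rw [← Finset.mul_sum, ← lintegral_finsetSum _ fun j _ => hF'.fun_mul (hhm j)]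
    gcongr with x
    rw [← Finset.mul_sum, hsum, mul_comm]
  have hw2 : ∫⁻ x, w x ^ 2 ∂μ ≤ 12 * ∫⁻ x, F x * F' x ∂μ := by
    calc ∫⁻ x, w x ^ 2 ∂μ
        = ∑ i ∈ s, ∑ j ∈ s, ∫⁻ x, orbitAvg v i (h i) x * orbitAvg v j (h j) x ∂μ := by
          simp_rw [hw_def, sq, Finset.sum_mul_sum]
          rw [lintegral_finsetSum _ fun i _ =>
            Finset.measurable_sum _ fun j _ => (havg i i).fun_mul (havg j j)]
          exact Finset.sum_congr rfl fun i _ =>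
            lintegral_finsetSum _ fun j _ => (havg i i).fun_mul (havg j j)
      _ ≤ ∑ i ∈ s, ∑ j ∈ s, (d i j + d j i) :=
          Finset.sum_le_sum fun i _ => Finset.sum_le_sum fun j _ => hcle' i j
      _ = 2 * ∑ j ∈ s, ∑ i ∈ s, d i j := by
          simp_rw [Finset.sum_add_distrib]
          rw [Finset.sum_comm, two_mul]
      _ ≤ 2 * (6 * ∫⁻ x, F x * F' x ∂μ) := by gcongr
      _ = 12 * ∫⁻ x, F x * F' x ∂μ := by rw [← mul_assoc]; norm_num
  have hFF : ∫⁻ x, F x * F' x ∂μ ≤ 12 * y * a := by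
    have e1 : (∫⁻ x, F x * F' x ∂μ) ^ 2 ≤ (12 * y * a) ^ 2 := by
      calc _ ≤ a * ∫⁻ x, F' x ^ 2 ∂μ := sq_lintegral_mul_le hF hF'
        _ ≤ a * ((12 * y) ^ 2 * a) := by gcongr; exact H F hF
        _ = _ := by ring
    exact (ENNReal.pow_le_pow_left_iff (by norm_num)).1 e1
  -- One factor `a`, finite and nonzero, cancels. The constant `(12 * y) ^ 2` at `J + 1` has become
  -- `144 * y` at `J`: apart from the 144, its square root has been taken.
  have hfin : a * a ≤ a * (144 * y * b) := by
    calc a * a = a ^ 2 := (sq a).symm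
      _ ≤ b * (12 * (12 * y * a)) := hCS.trans (by gcongr; exact hw2.trans (by gcongr))
      _ = a * (12 * 12 * y * b) := by ring
      _ = a * (144 * y * b) := by norm_num
  exact (ENNReal.mul_le_mul_iff_right ha0 hatop).1 hfin

/-- Iterating the self-improvement `m` times takes a `2 ^ m`-th root of the crude bound at `J + m`,
while the factor 144 does not accumulate. -/
theorem lintegral_orbitMax_sq_le_of_pow (v : E) (m : ℕ) : ∀ (J : ℕ) (y : ℝ≥0∞),
    ((J + 1 + m : ℕ) : ℝ≥0∞) ≤ y ^ 2 ^ m → ∀ g : E → ℝ≥0∞, Measurable g →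
      ∫⁻ x, orbitMax v J g x ^ 2 ∂μ ≤ 144 * y * ∫⁻ x, g x ^ 2 ∂μ := by
  induction m with
  | zero =>
    intro J y hy g hg
    refine (lintegral_orbitMax_sq_le_card v J hg).trans ?_
    simp only [add_zero, pow_zero, pow_one] at hy
    gcongr
    norm_num
  | succ m ih =>
    intro J y hy g hg
    have hy0 : y ≠ 0 := by
      rintro rfl
      rw [zero_pow (by positivity)] at hy
      simp at hy
    refine lintegral_orbitMax_sq_le_of_succ v J y hy0 (fun g hg => ?_) hg
    have := ih (J + 1) (y ^ 2) ?_ g hg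
    · convert this using 2
      ring
    · rw [← pow_mul, ← pow_succ']
      convert hy using 2
      ring

/-- The `L²` maximal inequality for orbit averages. -/
theorem lintegral_iSup_orbitAvg_sq_le (v : E) {g : E → ℝ≥0∞} (hg : Measurable g) :
    ∫⁻ x, (⨆ j, orbitAvg v j g x) ^ 2 ∂μ ≤ 288 * ∫⁻ x, g x ^ 2 ∂μ := by
  have hsup : ∀ x, (⨆ j, orbitAvg v j g x) ^ 2 = ⨆ J, orbitMax v J g x ^ 2 := by
    intro x
    have : (⨆ j, orbitAvg v j g x) = ⨆ J, orbitMax v J g x := by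
      refine le_antisymm (iSup_mono fun j => ?_) (iSup_le fun J => Finset.sup_le fun j _ => ?_)
      · exact Finset.le_sup (f := fun j => orbitAvg v j g x) (by simp)
      · exact le_iSup (fun j => orbitAvg v j g x) j
    rw [this, ENNReal.iSup_pow]
  simp_rw [hsup]
  rw [lintegral_iSup (fun J => (measurable_orbitMax v J hg).pow_const 2)]
  · refine iSup_le fun J => ?_
    -- With `m = J + 1` iterations, `y = 2` suffices for every `J`, since `2 * (J + 1) ≤ 2 ^ 2 ^ (J
    -- + 1)`.
    have := lintegral_orbitMax_sq_le_of_pow (μ := μ) v (J + 1) J 2 ?_ g hg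
    · refine this.trans (le_of_eq ?_)
      norm_num
    · have h1 : J + 1 < 2 ^ (J + 1) := Nat.lt_two_pow_self
      have h2 : 2 ^ (J + 1) < 2 ^ 2 ^ (J + 1) := Nat.pow_lt_pow_right (by norm_num) h1
      have h3 : J + 1 + (J + 1) ≤ 2 ^ 2 ^ (J + 1) := by
        have : 2 ^ (J + 2) ≤ 2 ^ 2 ^ (J + 1) := Nat.pow_le_pow_right (by norm_num) h1
        have h4 : 2 ^ (J + 2) = 2 * 2 ^ (J + 1) := by ring
        omega
      exact_mod_cast h3
  · intro J J' hJ x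
    dsimp only
    gcongr
    exact Finset.sup_mono (Finset.range_mono (by omega))

end OrbitAverages

/-! ### Fourier multipliers on `L²` and Plancherel -/

/-- Bounded measurable functions, the symbols of Fourier multiplier operators. -/
def IsSymbol (m : Plane → ℂ) : Prop :=
  Measurable m ∧ ∃ c : ℝ, ∀ ξ, ‖m ξ‖ ≤ c

theorem IsSymbol.add {m m' : Plane → ℂ} (hm : IsSymbol m) (hm' : IsSymbol m') :
    IsSymbol fun ξ => m ξ + m' ξ := by
  obtain ⟨h1, c, hc⟩ := hm
  obtain ⟨h2, c', hc'⟩ := hm'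
  exact ⟨h1.add h2, c + c', fun ξ => norm_add_le_of_le (hc ξ) (hc' ξ)⟩

theorem IsSymbol.mul {m m' : Plane → ℂ} (hm : IsSymbol m) (hm' : IsSymbol m') :
    IsSymbol fun ξ => m ξ * m' ξ := by
  obtain ⟨h1, c, hc⟩ := hm
  obtain ⟨h2, c', hc'⟩ := hm'
  refine ⟨h1.mul h2, c * c', fun ξ => ?_⟩
  rw [norm_mul]
  exact mul_le_mul (hc ξ) (hc' ξ) (norm_nonneg _) ((norm_nonneg _).trans (hc ξ))

theorem isSymbol_const (a : ℂ) : IsSymbol fun _ => a :=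
  ⟨measurable_const, ‖a‖, fun _ => le_rfl⟩

theorem isSymbol_sum {ι : Type*} (s : Finset ι) {m : ι → Plane → ℂ} (hm : ∀ i, IsSymbol (m i)) :
    IsSymbol fun ξ => ∑ i ∈ s, m i ξ := by
  classical
  induction s using Finset.induction_on with
  | empty => simpa using isSymbol_const 0
  | insert a s ha ih => simpa [Finset.sum_insert ha] using (hm a).add ih

theorem IsSymbol.memLp {m : Plane → ℂ} (hm : IsSymbol m) (g : L2) :
    MemLp (fun ξ => m ξ * g ξ) 2 volume := by
  obtain ⟨h1, c, hc⟩ := hm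
  refine MemLp.of_le_mul (c := c) (Lp.memLp g)
    (h1.aestronglyMeasurable.mul (Lp.aestronglyMeasurable g)) (.of_forall fun ξ => ?_)
  rw [norm_mul]
  exact mul_le_mul_of_nonneg_right (hc ξ) (norm_nonneg _)

open Classical in
/-- Multiplication of an `L²` function by a symbol. -/
noncomputable def mulL2 (m : Plane → ℂ) (g : L2) : L2 :=
  if h : MemLp (fun ξ => m ξ * g ξ) 2 volume then h.toLp _ else 0

theorem coeFn_mulL2 {m : Plane → ℂ} (hm : IsSymbol m) (g : L2) :
    mulL2 m g =ᵐ[volume] fun ξ => m ξ * g ξ := by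
  rw [mulL2, dif_pos (hm.memLp g)]
  exact MemLp.coeFn_toLp _

theorem mulL2_mulL2 {m m' : Plane → ℂ} (hm : IsSymbol m) (hm' : IsSymbol m') (g : L2) :
    mulL2 m (mulL2 m' g) = mulL2 (fun ξ => m ξ * m' ξ) g := by
  apply Lp.ext
  filter_upwards [coeFn_mulL2 hm (mulL2 m' g), coeFn_mulL2 hm' g, coeFn_mulL2 (hm.mul hm') g]
    with ξ h1 h2 h3
  rw [h1, h2, h3, mul_assoc]

theorem mulL2_add_symbol {m m' : Plane → ℂ} (hm : IsSymbol m) (hm' : IsSymbol m') (g : L2) :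
    mulL2 (fun ξ => m ξ + m' ξ) g = mulL2 m g + mulL2 m' g := by
  apply Lp.ext
  filter_upwards [coeFn_mulL2 hm g, coeFn_mulL2 hm' g, coeFn_mulL2 (hm.add hm') g,
    Lp.coeFn_add (mulL2 m g) (mulL2 m' g)] with ξ h1 h2 h3 h4
  rw [h3, h4, Pi.add_apply, h1, h2, add_mul]

theorem mulL2_const (a : ℂ) (g : L2) : mulL2 (fun _ => a) g = a • g := by
  apply Lp.ext
  filter_upwards [coeFn_mulL2 (isSymbol_const a) g, Lp.coeFn_smul a g] with ξ h1 h2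
  rw [h1, h2, Pi.smul_apply, smul_eq_mul]

theorem mulL2_sub {m : Plane → ℂ} (hm : IsSymbol m) (g g' : L2) :
    mulL2 m (g - g') = mulL2 m g - mulL2 m g' := by
  apply Lp.ext
  filter_upwards [coeFn_mulL2 hm g, coeFn_mulL2 hm g', coeFn_mulL2 hm (g - g'),
    Lp.coeFn_sub (mulL2 m g) (mulL2 m g'), Lp.coeFn_sub g g'] with ξ h1 h2 h3 h4 h5
  rw [h3, h4, Pi.sub_apply, h1, h2, h5, Pi.sub_apply, mul_sub]

theorem norm_mulL2_le {m : Plane → ℂ} (hm : Measurable m) (h1 : ∀ ξ, ‖m ξ‖ ≤ 1) (g : L2) :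
    ‖mulL2 m g‖ ≤ ‖g‖ := by
  refine Lp.norm_le_norm_of_ae_le ?_
  filter_upwards [coeFn_mulL2 ⟨hm, 1, h1⟩ g] with ξ h
  rw [h, norm_mul]
  exact mul_le_of_le_one_left (norm_nonneg _) (h1 ξ)

/-- The Fourier multiplier operator with symbol `m`. -/
noncomputable def fourierMul (m : Plane → ℂ) (f : L2) : L2 := 𝓕⁻ (mulL2 m (𝓕 f))

theorem fourierMul_fourierMul {m m' : Plane → ℂ} (hm : IsSymbol m) (hm' : IsSymbol m') (f : L2) :
    fourierMul m (fourierMul m' f) = fourierMul (fun ξ => m ξ * m' ξ) f := by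
  unfold fourierMul
  rw [FourierTransform.fourier_fourierInv_eq, mulL2_mulL2 hm hm']

theorem fourierMul_add_symbol {m m' : Plane → ℂ} (hm : IsSymbol m) (hm' : IsSymbol m') (f : L2) :
    fourierMul (fun ξ => m ξ + m' ξ) f = fourierMul m f + fourierMul m' f := by
  unfold fourierMul
  rw [mulL2_add_symbol hm hm', FourierTransform.fourierInv_add]

theorem fourierMul_const (a : ℂ) (f : L2) : fourierMul (fun _ => a) f = a • f := by
  unfold fourierMul
  rw [mulL2_const, FourierTransform.fourierInv_smul, FourierTransform.fourierInv_fourier_eq]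

theorem fourierMul_sum_symbol {ι : Type*} (s : Finset ι) {m : ι → Plane → ℂ}
    (hm : ∀ i, IsSymbol (m i)) (f : L2) :
    fourierMul (fun ξ => ∑ i ∈ s, m i ξ) f = ∑ i ∈ s, fourierMul (m i) f := by
  classical
  induction s using Finset.induction_on with
  | empty => simpa using fourierMul_const 0 f
  | insert a s ha ih =>
    simp only [Finset.sum_insert ha]
    rw [fourierMul_add_symbol (hm a) (isSymbol_sum s hm), ih]

theorem lintegral_sq_eq_enorm_sq (f : L2) : ∫⁻ x, ‖f x‖ₑ ^ 2 = ‖f‖ₑ ^ 2 := by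
  rw [Lp.enorm_def, eLpNorm_eq_lintegral_rpow_enorm_toReal (by norm_num) (by norm_num)]
  rw [← ENNReal.rpow_natCast (_ ^ (_ : ℝ)), ← ENNReal.rpow_mul]
  norm_num

theorem lintegral_fourierMul_sq {m : Plane → ℂ} (hm : IsSymbol m) (f : L2) :
    ∫⁻ x, ‖fourierMul m f x‖ₑ ^ 2 = ∫⁻ ξ, ‖m ξ‖ₑ ^ 2 * ‖𝓕 f ξ‖ₑ ^ 2 := by
  have h1 : ‖fourierMul m f‖ₑ = ‖mulL2 m (𝓕 f)‖ₑ := by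
    have : ‖fourierMul m f‖ = ‖mulL2 m (𝓕 f)‖ := by
      rw [← Lp.norm_fourier_eq, fourierMul, FourierTransform.fourier_fourierInv_eq]
    rw [← ofReal_norm, ← ofReal_norm, this]
  rw [lintegral_sq_eq_enorm_sq, h1, ← lintegral_sq_eq_enorm_sq]
  refine lintegral_congr_ae ?_
  filter_upwards [coeFn_mulL2 hm (𝓕 f)] with ξ h
  rw [h, enorm_mul, mul_pow]

theorem lintegral_fourier_sq (f : L2) : ∫⁻ ξ, ‖𝓕 f ξ‖ₑ ^ 2 = ∫⁻ x, ‖f x‖ₑ ^ 2 := by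
  rw [lintegral_sq_eq_enorm_sq, lintegral_sq_eq_enorm_sq, ← ofReal_norm, ← ofReal_norm,
    Lp.norm_fourier_eq]

/-! ### Characters as symbols of translations -/

/-- The character `ξ ↦ e(v · ξ)`. -/
noncomputable def charSymbol (v : Plane) (ξ : Plane) : ℂ := (Real.fourierChar (inner ℝ v ξ) : ℂ)

theorem norm_charSymbol (v ξ : Plane) : ‖charSymbol v ξ‖ = 1 := Circle.norm_coe _

theorem measurable_charSymbol (v : Plane) : Measurable (charSymbol v) := by
  have : Continuous (charSymbol v) := by
    unfold charSymbol
    exact continuous_subtype_val.comp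
      (Real.continuous_fourierChar.comp (continuous_const.inner continuous_id))
  exact this.measurable

theorem isSymbol_charSymbol (v : Plane) : IsSymbol (charSymbol v) :=
  ⟨measurable_charSymbol v, 1, fun ξ => (norm_charSymbol v ξ).le⟩

/-- Translation on `L²`. -/
noncomputable def translate (v : Plane) (f : L2) : L2 :=
  Lp.compMeasurePreserving (fun x => x + v) (measurePreserving_add_right volume v) f

theorem coeFn_translate (v : Plane) (f : L2) :
    translate v f =ᵐ[volume] fun x => f (x + v) :=
  Lp.coeFn_compMeasurePreserving f _

theorem exists_schwartz_translate (v : Plane) (φ : SchwartzMap Plane ℂ) :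
    ∃ ψ : SchwartzMap Plane ℂ, ∀ x, ψ x = φ (x + v) := by
  have hg : (fun x : Plane => x + v).HasTemperateGrowth := by fun_prop
  have hanti : AntilipschitzWith 1 (fun x : Plane => x + v) :=
    (isometry_add_right v).antilipschitz
  exact ⟨SchwartzMap.compCLMOfAntilipschitz ℂ hg hanti φ, fun x => rfl⟩

/-- Both sides are continuous in `f`, so it is enough to treat Schwartz functions, where the Fourier
integral can be shifted directly. -/
theorem fourier_translate (v : Plane) (f : L2) :
    𝓕 (translate v f) = mulL2 (charSymbol v) (𝓕 f) := by
  have hiso : Isometry (translate v) := by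
    exact Lp.isometry_compMeasurePreserving (measurePreserving_add_right volume v)
  have hmul : Continuous (mulL2 (charSymbol v)) := by
    refine (LipschitzWith.of_dist_le_mul (K := 1) fun g g' => ?_).continuous
    rw [dist_eq_norm, dist_eq_norm, ← mulL2_sub (isSymbol_charSymbol v), NNReal.coe_one, one_mul]
    exact norm_mulL2_le (measurable_charSymbol v) (fun ξ => (norm_charSymbol v ξ).le) _
  have hF : Continuous fun g : L2 => 𝓕 g := FourierTransform.continuous_fourier
  refine DenseRange.induction_on (p := fun f : L2 =>
    𝓕 (translate v f) = mulL2 (charSymbol v) (𝓕 f))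
    (SchwartzMap.denseRange_toLpCLM (p := 2) ENNReal.ofNat_ne_top) f
    (isClosed_eq (hF.comp hiso.continuous) (hmul.comp hF)) fun φ => ?_
  obtain ⟨ψ, hψ⟩ := exists_schwartz_translate v φ
  have h1 : translate v (φ.toLp 2) = ψ.toLp 2 := by
    apply Lp.ext
    have h := (measurePreserving_add_right (volume : Measure Plane) v).quasiMeasurePreserving.ae
      (φ.coeFn_toLp 2 volume)
    filter_upwards [coeFn_translate v (φ.toLp 2), ψ.coeFn_toLp 2 volume, h] with x h1 h2 h3
    rw [h1, h2, hψ, h3]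
  rw [SchwartzMap.toLpCLM_apply, h1, SchwartzMap.toLp_fourier_eq, SchwartzMap.toLp_fourier_eq]
  apply Lp.ext
  filter_upwards [coeFn_mulL2 (isSymbol_charSymbol v) ((𝓕 φ).toLp 2),
    (𝓕 φ).coeFn_toLp 2 volume, (𝓕 ψ).coeFn_toLp 2 volume] with ξ h1 h2 h3
  rw [h3, h1, h2, SchwartzMap.fourier_coe, SchwartzMap.fourier_coe]
  have hψ' : (ψ : Plane → ℂ) = (φ : Plane → ℂ) ∘ fun x => x + v := funext hψ
  rw [hψ', Real.fourier_eq, Real.fourier_eq]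
  have := VectorFourier.fourierIntegral_comp_add_right Real.fourierChar (volume : Measure Plane)
    (innerₗ Plane) (φ : Plane → ℂ) v
  have := congrFun this ξ
  simpa [VectorFourier.fourierIntegral, charSymbol, Circle.smul_def] using this

theorem fourierMul_charSymbol (v : Plane) (f : L2) :
    fourierMul (charSymbol v) f =ᵐ[volume] fun x => f (x + v) := by
  rw [fourierMul, ← fourier_translate, FourierTransform.fourierInv_fourier_eq]
  exact coeFn_translate v f

/-! ### Maximal bounds and the calculus of tensor bounds -/

theorem eLpNorm_two_sq {α ε : Type*} [MeasurableSpace α] [TopologicalSpace ε]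
    [ContinuousENorm ε] (μ : Measure α) (F : α → ε) :
    eLpNorm F 2 μ ^ 2 = ∫⁻ x, ‖F x‖ₑ ^ 2 ∂μ := by
  rw [eLpNorm_eq_lintegral_rpow_enorm_toReal (by norm_num) (by norm_num)]
  rw [← ENNReal.rpow_natCast (_ ^ (_ : ℝ)), ← ENNReal.rpow_mul]
  norm_num

theorem eLpNorm_two_le_iff {F : Plane → ℝ≥0∞} {f : L2} {c : ℝ≥0∞} :
    eLpNorm F 2 volume ≤ c * eLpNorm f 2 volume ↔
      ∫⁻ x, F x ^ 2 ≤ c ^ 2 * ∫⁻ x, ‖f x‖ₑ ^ 2 := by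
  rw [← ENNReal.pow_le_pow_left_iff (n := 2) (by norm_num), mul_pow, eLpNorm_two_sq,
    eLpNorm_two_sq]
  simp

theorem measurable_enorm_coeFn (f : L2) : Measurable fun x => ‖f x‖ₑ :=
  (Lp.stronglyMeasurable f).measurable.enorm

/-- The maximal operator of the multipliers `B k` is bounded on `L²` by `c`. -/
def MaxBound (B : ℕ → Plane → ℂ) (c : ℝ≥0∞) : Prop :=
  ∀ f : L2, eLpNorm (fun x => ⨆ k, ‖fourierMul (B k) f x‖ₑ) 2 volume ≤ c * eLpNorm f 2 volume

/-- The family `A` of symbols multiplies the bound for the maximal operator of any second family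
by at most `c`, when all products are formed. -/
def TensorBound (A : ℕ → Plane → ℂ) (c : ℝ≥0∞) : Prop :=
  (∀ n, IsSymbol (A n)) ∧ ∀ (B : ℕ → Plane → ℂ) (c' : ℝ≥0∞), (∀ k, IsSymbol (B k)) →
    MaxBound B c' → ∀ f : L2,
      eLpNorm (fun x => ⨆ n, ⨆ k, ‖fourierMul (fun ξ => A n ξ * B k ξ) f x‖ₑ) 2 volume ≤
        c * c' * eLpNorm f 2 volume

theorem maxBound_one : MaxBound (fun _ _ => 1) 1 := by
  intro f
  simp only [ciSup_const, fourierMul_const, one_smul, one_mul]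
  exact (eLpNorm_enorm _).le

theorem TensorBound.maxBound {A : ℕ → Plane → ℂ} {c : ℝ≥0∞} (h : TensorBound A c) :
    MaxBound A c := by
  intro f
  have := h.2 (fun _ _ => 1) 1 (fun _ => isSymbol_const 1) maxBound_one f
  simpa using this

theorem TensorBound.comp {A : ℕ → Plane → ℂ} {c : ℝ≥0∞} (h : TensorBound A c) (φ : ℕ → ℕ) :
    TensorBound (fun n => A (φ n)) c := by
  refine ⟨fun n => h.1 _, fun B c' hB hBc f => ?_⟩
  refine (eLpNorm_mono_enorm fun x => ?_).trans (h.2 B c' hB hBc f)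
  simp only [enorm_eq_self]
  exact iSup_le fun n => le_iSup
    (fun n => ⨆ k, ‖fourierMul (fun ξ => A n ξ * B k ξ) f x‖ₑ) (φ n)

theorem TensorBound.add {A A' : ℕ → Plane → ℂ} {c c' : ℝ≥0∞} (h : TensorBound A c)
    (h' : TensorBound A' c') : TensorBound (fun n ξ => A n ξ + A' n ξ) (c + c') := by
  refine ⟨fun n => (h.1 n).add (h'.1 n), fun B b hB hBb f => ?_⟩
  set F : Plane → ℝ≥0∞ := fun x => ⨆ n, ⨆ k, ‖fourierMul (fun ξ => A n ξ * B k ξ) f x‖ₑ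
  set F' : Plane → ℝ≥0∞ := fun x => ⨆ n, ⨆ k, ‖fourierMul (fun ξ => A' n ξ * B k ξ) f x‖ₑ
  have hF : Measurable F :=
    Measurable.iSup fun n => Measurable.iSup fun k => measurable_enorm_coeFn _
  have hF' : Measurable F' :=
    Measurable.iSup fun n => Measurable.iSup fun k => measurable_enorm_coeFn _
  have hae : ∀ᵐ x, ∀ n k, fourierMul (fun ξ => (A n ξ + A' n ξ) * B k ξ) f x =
      fourierMul (fun ξ => A n ξ * B k ξ) f x + fourierMul (fun ξ => A' n ξ * B k ξ) f x := by
    refine ae_all_iff.2 fun n => ae_all_iff.2 fun k => ?_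
    have e : fourierMul (fun ξ => (A n ξ + A' n ξ) * B k ξ) f =
        fourierMul (fun ξ => A n ξ * B k ξ) f + fourierMul (fun ξ => A' n ξ * B k ξ) f := by
      rw [← fourierMul_add_symbol ((h.1 n).mul (hB k)) ((h'.1 n).mul (hB k))]
      simp only [add_mul]
    rw [e]
    exact Lp.coeFn_add _ _
  calc eLpNorm (fun x => ⨆ n, ⨆ k, ‖fourierMul (fun ξ => (A n ξ + A' n ξ) * B k ξ) f x‖ₑ) 2 volume
      ≤ eLpNorm (F + F') 2 volume := by
        refine eLpNorm_mono_enorm_ae ?_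
        filter_upwards [hae] with x hx
        simp only [enorm_eq_self]
        refine iSup_le fun n => iSup_le fun k => ?_
        rw [hx]
        refine (enorm_add_le _ _).trans (add_le_add ?_ ?_)
        · exact le_iSup_of_le n (le_iSup_of_le k le_rfl)
        · exact le_iSup_of_le n (le_iSup_of_le k le_rfl)
    _ ≤ eLpNorm F 2 volume + eLpNorm F' 2 volume :=
        eLpNorm_add_le hF.aestronglyMeasurable hF'.aestronglyMeasurable (by norm_num)
    _ ≤ c * b * eLpNorm f 2 volume + c' * b * eLpNorm f 2 volume :=
        add_le_add (h.2 B b hB hBb f) (h'.2 B b hB hBb f)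
    _ = (c + c') * b * eLpNorm f 2 volume := by ring

/-- A square function estimate gives a tensor bound. -/
theorem tensorBound_of_tsum_sq_le {s : ℕ → Plane → ℂ} {c : ℝ≥0∞} (hs : ∀ n, IsSymbol (s n))
    (hsq : ∀ ξ, ∑' n, ‖s n ξ‖ₑ ^ 2 ≤ c ^ 2) : TensorBound s c := by
  refine ⟨hs, fun B b hB hBb f => ?_⟩
  rw [eLpNorm_two_le_iff]
  -- Multipliers commute, so the bound for `B` can be applied to each `fourierMul (s n) f`; the
  -- squares are then summed over `n` by Plancherel.
  have hcomm : ∀ n k, fourierMul (fun ξ => s n ξ * B k ξ) f =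
      fourierMul (B k) (fourierMul (s n) f) := by
    intro n k
    rw [fourierMul_fourierMul (hB k) (hs n)]
    simp only [mul_comm]
  simp_rw [hcomm]
  have hm : ∀ n, Measurable fun x => (⨆ k, ‖fourierMul (B k) (fourierMul (s n) f) x‖ₑ) ^ 2 :=
    fun n => (Measurable.iSup fun k => measurable_enorm_coeFn _).pow_const 2
  calc ∫⁻ x, (⨆ n, ⨆ k, ‖fourierMul (B k) (fourierMul (s n) f) x‖ₑ) ^ 2
      ≤ ∫⁻ x, ∑' n, (⨆ k, ‖fourierMul (B k) (fourierMul (s n) f) x‖ₑ) ^ 2 := by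
        refine lintegral_mono fun x => ?_
        rw [ENNReal.iSup_pow]
        exact iSup_le fun n => ENNReal.le_tsum n
    _ = ∑' n, ∫⁻ x, (⨆ k, ‖fourierMul (B k) (fourierMul (s n) f) x‖ₑ) ^ 2 :=
        lintegral_tsum fun n => (hm n).aemeasurable
    _ ≤ ∑' n, b ^ 2 * ∫⁻ x, ‖fourierMul (s n) f x‖ₑ ^ 2 :=
        ENNReal.tsum_le_tsum fun n => eLpNorm_two_le_iff.1 (hBb _)
    _ = b ^ 2 * ∫⁻ ξ, (∑' n, ‖s n ξ‖ₑ ^ 2) * ‖𝓕 f ξ‖ₑ ^ 2 := by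
        rw [ENNReal.tsum_mul_left]
        simp_rw [fun n => lintegral_fourierMul_sq (hs n) f, ← ENNReal.tsum_mul_right]
        rw [lintegral_tsum fun n => ((hs n).1.enorm.pow_const 2 |>.fun_mul
          ((measurable_enorm_coeFn _).pow_const 2)).aemeasurable]
    _ ≤ b ^ 2 * ∫⁻ ξ, c ^ 2 * ‖𝓕 f ξ‖ₑ ^ 2 := by
        gcongr with ξ
        exact hsq ξ
    _ = (c * b) ^ 2 * ∫⁻ x, ‖f x‖ₑ ^ 2 := by
        rw [lintegral_const_mul _ ((measurable_enorm_coeFn _).pow_const 2), lintegral_fourier_sq]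
        ring

theorem tensorBound_const {r : Plane → ℂ} (hr : Measurable r) (h1 : ∀ ξ, ‖r ξ‖ ≤ 1) :
    TensorBound (fun _ => r) 1 := by
  -- A constant sequence is not square-summable; a sequence supported at `n = 0` is, and reindexing
  -- by `n ↦ 0` makes it constant.
  have h : TensorBound (fun n => if n = 0 then r else fun _ => 0) 1 := by
    refine tensorBound_of_tsum_sq_le (fun n => ?_) fun ξ => ?_
    · split_ifs
      exacts [⟨hr, 1, h1⟩, isSymbol_const 0]
    · rw [tsum_eq_single 0 (fun n hn => by simp [hn])]
      simp only [if_true, one_pow]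
      refine pow_le_one₀ zero_le ?_
      rw [← ofReal_norm]
      exact ENNReal.ofReal_le_one.2 (h1 ξ)
  simpa using h.comp fun _ => 0

theorem eLpNorm_fourierMul_le {r : Plane → ℂ} (hr : Measurable r) (h1 : ∀ ξ, ‖r ξ‖ ≤ 1) (f : L2) :
    eLpNorm (fourierMul r f) 2 volume ≤ eLpNorm f 2 volume := by
  have := (tensorBound_const hr h1).maxBound f
  simp only [ciSup_const, one_mul] at this
  exact (eLpNorm_enorm _).symm.le.trans this

theorem TensorBound.mul_right {A : ℕ → Plane → ℂ} {c : ℝ≥0∞} (h : TensorBound A c)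
    {r : Plane → ℂ} (hr : Measurable r) (h1 : ∀ ξ, ‖r ξ‖ ≤ 1) :
    TensorBound (fun n ξ => A n ξ * r ξ) c := by
  have hrs : IsSymbol r := ⟨hr, 1, h1⟩
  refine ⟨fun n => (h.1 n).mul hrs, fun B b hB hBb f => ?_⟩
  have e : ∀ n k, fourierMul (fun ξ => A n ξ * r ξ * B k ξ) f =
      fourierMul (fun ξ => A n ξ * B k ξ) (fourierMul r f) := by
    intro n k
    rw [fourierMul_fourierMul ((h.1 n).mul (hB k)) hrs]
    simp only [mul_right_comm]
  simp_rw [e]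
  refine (h.2 B b hB hBb _).trans ?_
  gcongr
  exact eLpNorm_fourierMul_le hr h1 f

theorem tensorBound_sum {A : ℕ → ℕ → Plane → ℂ} {c : ℝ≥0∞} (h : ∀ t, TensorBound (A t) c)
    (T : ℕ) : TensorBound (fun n ξ => ∑ t ∈ Finset.range T, A t n ξ) (T * c) := by
  induction T with
  | zero =>
    simpa using (tensorBound_of_tsum_sq_le (s := fun _ _ => 0) (c := 0)
      (fun _ => isSymbol_const 0) (by simp))
  | succ T ih =>
    simp only [Finset.sum_range_succ]
    have := ih.add (h T)
    convert this using 1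
    push_cast
    ring

/-! ### Translation averages as multipliers -/

/-- The symbol of the average over the translations by `0, v, …, (2^m - 1) v`. -/
noncomputable def avgSymbol (v : Plane) (m : ℕ) (ξ : Plane) : ℂ :=
  ((2 : ℂ) ^ m)⁻¹ * ∑ k ∈ Finset.range (2 ^ m), charSymbol (k • v) ξ

theorem isSymbol_avgSymbol (v : Plane) (m : ℕ) : IsSymbol (avgSymbol v m) :=
  (isSymbol_const _).mul (isSymbol_sum _ fun _ => isSymbol_charSymbol _)

theorem enorm_fourierMul_avgSymbol_le (v : Plane) (m : ℕ) (g : L2) :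
    ∀ᵐ x, ‖fourierMul (avgSymbol v m) g x‖ₑ ≤ orbitAvg v m (fun y => ‖g y‖ₑ) x := by
  have e : fourierMul (avgSymbol v m) g =
      ((2 : ℂ) ^ m)⁻¹ • ∑ k ∈ Finset.range (2 ^ m), fourierMul (charSymbol (k • v)) g := by
    rw [← fourierMul_sum_symbol _ fun k => isSymbol_charSymbol (k • v), ← fourierMul_const,
      fourierMul_fourierMul (isSymbol_const _) (isSymbol_sum _ fun k => isSymbol_charSymbol _)]
    rfl
  have hk : ∀ᵐ x, ∀ k : ℕ, fourierMul (charSymbol (k • v)) g x = g (x + k • v) :=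
    ae_all_iff.2 fun k => fourierMul_charSymbol (k • v) g
  rw [e]
  filter_upwards [hk, Lp.coeFn_smul ((2 : ℂ) ^ m)⁻¹
      (∑ k ∈ Finset.range (2 ^ m), fourierMul (charSymbol (k • v)) g),
    Lp.coeFn_finsetSum (Finset.range (2 ^ m)) fun k => fourierMul (charSymbol (k • v)) g]
    with x h1 h2 h3
  rw [h2, Pi.smul_apply, h3, Finset.sum_apply, enorm_smul, orbitAvg]
  have h2m : ‖((2 : ℂ) ^ m)⁻¹‖ₑ = ((2 : ℝ≥0∞) ^ m)⁻¹ := by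
    rw [enorm_inv (by simp), enorm_pow]
    congr 2
    rw [← ofReal_norm]
    simp
  rw [h2m]
  gcongr
  simp_rw [h1]
  refine (enorm_sum_le _ _).trans ?_
  have : ∑ k ∈ Finset.range (2 ^ m), ‖g (x + k • v)‖ₑ =
      ∑ k ∈ (Finset.range (2 ^ m)).image (fun k : ℕ => (k : ℤ)), ‖g (x + k • v)‖ₑ := by
    rw [Finset.sum_image (by intro a _ b _ h; simpa using h)]
    simp
  rw [this]
  refine Finset.sum_le_sum_of_subset fun k hk => ?_
  obtain ⟨a, ha, rfl⟩ := Finset.mem_image.1 hk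
  rw [Finset.mem_range] at ha
  have h2 : ((2 ^ m : ℕ) : ℤ) = 2 ^ m := by push_cast; rfl
  rw [Finset.mem_Icc]
  omega

/-- Positivity lets the supremum over `k` be taken inside the average, so the orbit maximal
inequality is applied to the maximal function of `B` itself. The constant comes from `288 ≤ 17 ^ 2`.
-/
theorem tensorBound_avgSymbol (v : Plane) : TensorBound (avgSymbol v) 17 := by
  refine ⟨isSymbol_avgSymbol v, fun B b hB hBb f => ?_⟩
  rw [eLpNorm_two_le_iff]
  set G : Plane → ℝ≥0∞ := fun x => ⨆ k, ‖fourierMul (B k) f x‖ₑ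
  have hG : Measurable G := Measurable.iSup fun k => measurable_enorm_coeFn _
  have hae : ∀ᵐ x, ∀ n k, ‖fourierMul (fun ξ => avgSymbol v n ξ * B k ξ) f x‖ₑ ≤
      orbitAvg v n G x := by
    refine ae_all_iff.2 fun n => ae_all_iff.2 fun k => ?_
    rw [← fourierMul_fourierMul (isSymbol_avgSymbol v n) (hB k)]
    filter_upwards [enorm_fourierMul_avgSymbol_le v n (fourierMul (B k) f)] with x hx
    exact hx.trans (orbitAvg_mono v n (fun y => le_iSup (fun k => ‖fourierMul (B k) f y‖ₑ) k) x)
  calc ∫⁻ x, (⨆ n, ⨆ k, ‖fourierMul (fun ξ => avgSymbol v n ξ * B k ξ) f x‖ₑ) ^ 2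
      ≤ ∫⁻ x, (⨆ n, orbitAvg v n G x) ^ 2 := by
        refine lintegral_mono_ae ?_
        filter_upwards [hae] with x hx
        gcongr
        exact iSup_le fun k => hx _ k
    _ ≤ 288 * ∫⁻ x, G x ^ 2 := lintegral_iSup_orbitAvg_sq_le v hG
    _ ≤ 17 ^ 2 * (b ^ 2 * ∫⁻ x, ‖f x‖ₑ ^ 2) := by
        gcongr
        · norm_num
        · exact eLpNorm_two_le_iff.1 (hBb f)
    _ = (17 * b) ^ 2 * ∫⁻ x, ‖f x‖ₑ ^ 2 := by ring

/-! ### Sharp cutoffs and the Rademacher–Menshov argument -/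

/-- The complex-valued indicator function of a set of frequencies. -/
noncomputable def ind (S : Set Plane) : Plane → ℂ := S.indicator fun _ => 1

theorem ind_of_mem {S : Set Plane} {ξ : Plane} (h : ξ ∈ S) : ind S ξ = 1 :=
  Set.indicator_of_mem h _

theorem ind_of_notMem {S : Set Plane} {ξ : Plane} (h : ξ ∉ S) : ind S ξ = 0 :=
  Set.indicator_of_notMem h _

theorem measurable_ind {S : Set Plane} (hS : MeasurableSet S) : Measurable (ind S) :=
  measurable_const.indicator hS

theorem norm_ind_le (S : Set Plane) (ξ : Plane) : ‖ind S ξ‖ ≤ 1 := by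
  by_cases h : ξ ∈ S
  · simp [ind_of_mem h]
  · simp [ind_of_notMem h]

theorem isSymbol_ind {S : Set Plane} (hS : MeasurableSet S) : IsSymbol (ind S) :=
  ⟨measurable_ind hS, 1, norm_ind_le S⟩

theorem IsSymbol.sub {m m' : Plane → ℂ} (hm : IsSymbol m) (hm' : IsSymbol m') :
    IsSymbol fun ξ => m ξ - m' ξ := by
  have := hm.add ((isSymbol_const (-1)).mul hm')
  simpa [sub_eq_add_neg] using this

/-- The sets decrease, so a given frequency leaves them at most once, and at most one `a` has that
exit inside its dyadic block. The square sum is therefore at most one, however many blocks there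
are. -/
theorem tensorBound_dyadic_block {U : ℕ → Set Plane} (hU : ∀ n, MeasurableSet (U n))
    (hanti : Antitone U) (t : ℕ) :
    TensorBound (fun a ξ => ind (U (a * 2 ^ t)) ξ - ind (U (a / 2 * 2 ^ (t + 1))) ξ) 1 := by
  refine tensorBound_of_tsum_sq_le (fun a => (isSymbol_ind (hU _)).sub (isSymbol_ind (hU _)))
    fun ξ => ?_
  have hle : ∀ a, a / 2 * 2 ^ (t + 1) ≤ a * 2 ^ t := by
    intro a
    rw [pow_succ', ← mul_assoc]
    exact Nat.mul_le_mul_right _ (Nat.div_mul_le_self a 2)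
  have hzero : ∀ a, ¬ (ξ ∈ U (a / 2 * 2 ^ (t + 1)) ∧ ξ ∉ U (a * 2 ^ t)) →
      ind (U (a * 2 ^ t)) ξ - ind (U (a / 2 * 2 ^ (t + 1))) ξ = 0 := by
    intro a ha
    by_cases h1 : ξ ∈ U (a * 2 ^ t)
    · rw [ind_of_mem h1, ind_of_mem (hanti (hle a) h1), sub_self]
    · have h2 : ξ ∉ U (a / 2 * 2 ^ (t + 1)) := fun h => ha ⟨h, h1⟩
      rw [ind_of_notMem h1, ind_of_notMem h2, sub_self]
  have hlt : ∀ a b, a < b → ξ ∉ U (a * 2 ^ t) → ξ ∉ U (b / 2 * 2 ^ (t + 1)) := by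
    intro a b hab ha hb
    refine ha (hanti ?_ hb)
    rw [pow_succ', ← mul_assoc]
    exact Nat.mul_le_mul_right _ (by omega)
  by_cases hex : ∃ a, ξ ∈ U (a / 2 * 2 ^ (t + 1)) ∧ ξ ∉ U (a * 2 ^ t)
  · obtain ⟨a, ha1, ha2⟩ := hex
    rw [tsum_eq_single a]
    · rw [ind_of_mem ha1, ind_of_notMem ha2]
      simp
    · intro b hb
      rw [hzero b]
      · simp
      · rintro ⟨hb1, hb2⟩
        rcases lt_or_gt_of_ne hb with h | h
        · exact hlt b a h hb2 ha1
        · exact hlt a b h ha2 hb1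
  · push Not at hex
    simp [fun a => hzero a fun h => h.2 (hex a h.1)]

/-- The Rademacher–Menshov bound for the first scales of a nested family. -/
theorem tensorBound_ind_min {U : ℕ → Set Plane} (hU : ∀ n, MeasurableSet (U n))
    (hanti : Antitone U) {L T : ℕ} (hLT : L < 2 ^ T) :
    TensorBound (fun n => ind (U (min n L))) (T + 1) := by
  have h1 := tensorBound_sum (fun t => (tensorBound_dyadic_block hU hanti t).comp
    fun n => min n L / 2 ^ t) T
  have h2 := h1.add (tensorBound_const (measurable_ind (hU 0)) (norm_ind_le _))
  convert h2 using 1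
  · funext n ξ
    -- Rounding `min n L` down to multiples of `2 ^ t` telescopes in `t`, from the index itself at
    -- `t = 0` to `0` at `t = T`.
    have hT : min n L / 2 ^ T = 0 := Nat.div_eq_of_lt (by omega)
    have := Finset.sum_range_sub (fun t => - ind (U (min n L / 2 ^ t * 2 ^ t)) ξ) T
    simp only [Nat.div_div_eq_div_mul, ← pow_succ]
    have e : ∀ t, ind (U (min n L / 2 ^ t * 2 ^ t)) ξ -
        ind (U (min n L / 2 ^ (t + 1) * 2 ^ (t + 1))) ξ =
        -ind (U (min n L / 2 ^ (t + 1) * 2 ^ (t + 1))) ξ -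
          -ind (U (min n L / 2 ^ t * 2 ^ t)) ξ := fun t => by ring
    simp_rw [e]
    rw [this, hT]
    simp
  · ring

/-! ### Dirichlet kernels and comparison of averages with sharp cutoffs -/

section Dirichlet

theorem norm_pow_sub_one_le {z : ℂ} (hz : ‖z‖ = 1) (k : ℕ) : ‖z ^ k - 1‖ ≤ k * ‖z - 1‖ := by
  rw [← geom_sum_mul, norm_mul]
  gcongr
  refine (norm_sum_le _ _).trans ?_
  simp [hz]

/-- The average of the powers of `z` is close to one when `z` is. -/
theorem norm_avg_pow_sub_one_le {z : ℂ} (hz : ‖z‖ = 1) {N : ℕ} (hN : 0 < N) :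
    ‖(N : ℂ)⁻¹ * ∑ k ∈ Finset.range N, z ^ k - 1‖ ≤ N * ‖z - 1‖ := by
  have hN' : (N : ℂ) ≠ 0 := by exact_mod_cast hN.ne'
  have e : (N : ℂ)⁻¹ * ∑ k ∈ Finset.range N, z ^ k - 1 =
      (N : ℂ)⁻¹ * ∑ k ∈ Finset.range N, (z ^ k - 1) := by
    rw [Finset.sum_sub_distrib, mul_sub]
    simp [hN']
  have hNr : (0 : ℝ) < N := by exact_mod_cast hN
  rw [e, norm_mul, norm_inv, Complex.norm_natCast, inv_mul_le_iff₀ hNr]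
  refine (norm_sum_le _ _).trans ?_
  calc ∑ k ∈ Finset.range N, ‖z ^ k - 1‖ ≤ ∑ k ∈ Finset.range N, N * ‖z - 1‖ := by
        refine Finset.sum_le_sum fun k hk => (norm_pow_sub_one_le hz k).trans ?_
        gcongr
        exact (Finset.mem_range.1 hk).le
    _ = N * (N * ‖z - 1‖) := by simp

/-- The average of the powers of `z` is small when `z` is far from one. -/
theorem norm_avg_pow_mul_le {z : ℂ} (hz : ‖z‖ = 1) (N : ℕ) :
    ‖(N : ℂ)⁻¹ * ∑ k ∈ Finset.range N, z ^ k‖ * (N * ‖z - 1‖) ≤ 2 := by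
  rcases Nat.eq_zero_or_pos N with rfl | hN
  · simp
  have hNr : (N : ℝ) ≠ 0 := by exact_mod_cast hN.ne'
  have e : ‖(N : ℂ)⁻¹ * ∑ k ∈ Finset.range N, z ^ k‖ * (N * ‖z - 1‖) = ‖z ^ N - 1‖ := by
    rw [← geom_sum_mul, norm_mul, norm_mul, norm_inv, Complex.norm_natCast]
    field_simp
  rw [e]
  refine (norm_sub_le _ _).trans ?_
  rw [norm_pow, hz]
  norm_num

theorem norm_exp_two_pi_sub_one_le (θ : ℝ) :
    ‖Complex.exp (2 * Real.pi * θ * Complex.I) - 1‖ ≤ 7 * |θ| := by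
  have h := Real.norm_exp_I_mul_ofReal_sub_one_le (x := 2 * Real.pi * θ)
  have e : Complex.I * ((2 * Real.pi * θ : ℝ) : ℂ) = 2 * Real.pi * θ * Complex.I := by
    push_cast; ring
  rw [e, Real.norm_eq_abs, abs_mul, abs_of_pos Real.two_pi_pos] at h
  refine h.trans ?_
  gcongr
  linarith [Real.pi_lt_d2]

theorem le_norm_exp_two_pi_sub_one {θ : ℝ} (hθ : |θ| ≤ 1 / 2) :
    4 * |θ| ≤ ‖Complex.exp (2 * Real.pi * θ * Complex.I) - 1‖ := by
  have h := Complex.norm_exp_I_mul_ofReal_sub_one (2 * Real.pi * θ)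
  have e : Complex.I * ((2 * Real.pi * θ : ℝ) : ℂ) = 2 * Real.pi * θ * Complex.I := by
    push_cast; ring
  rw [e] at h
  rw [h, norm_mul, Real.norm_eq_abs, Real.norm_eq_abs, show 2 * Real.pi * θ / 2 = Real.pi * θ by ring]
  have hs : |Real.pi * θ| ≤ Real.pi / 2 := by
    rw [abs_mul, abs_of_pos Real.pi_pos]
    nlinarith [Real.pi_pos]
  have := Real.mul_abs_le_abs_sin hs
  rw [abs_mul, abs_of_pos Real.pi_pos] at this
  have e2 : 2 / Real.pi * (Real.pi * |θ|) = 2 * |θ| := by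
    field_simp
  rw [e2] at this
  rw [abs_of_pos (by norm_num : (0 : ℝ) < 2)]
  linarith

end Dirichlet

/-- A bounded increasing function whose dyadic differences dominate `min (x, 1 / x) ^ 2`. -/
noncomputable def dyadicPotential (x : ℝ) : ℝ := x ^ 2 / (1 + x ^ 2)

theorem dyadicPotential_sub (x : ℝ) :
    dyadicPotential (2 * x) - dyadicPotential x = 3 * x ^ 2 / ((1 + 4 * x ^ 2) * (1 + x ^ 2)) := by
  have h1 : (1 + x ^ 2) ≠ 0 := by positivity
  have h2 : (1 + 4 * x ^ 2) ≠ 0 := by positivity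
  have h3 : (1 + (2 * x) ^ 2) = 1 + 4 * x ^ 2 := by ring
  unfold dyadicPotential
  rw [h3]
  field_simp
  ring

theorem sq_le_dyadicPotential_of_le {x y : ℝ} (hx : 0 ≤ x) (hx2 : x ≤ 1 / 2) (hy0 : 0 ≤ y)
    (hy : y ≤ 7 * x) : y ^ 2 ≤ 49 * (dyadicPotential (2 * x) - dyadicPotential x) := by
  rw [dyadicPotential_sub, mul_div_assoc', le_div_iff₀ (by positivity)]
  have h1 : y ^ 2 ≤ 49 * x ^ 2 := by nlinarith
  have h2 : x ^ 2 ≤ 1 / 4 := by nlinarith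
  have h3 : (1 + 4 * x ^ 2) * (1 + x ^ 2) ≤ 3 := by nlinarith [sq_nonneg x]
  calc y ^ 2 * ((1 + 4 * x ^ 2) * (1 + x ^ 2)) ≤ (49 * x ^ 2) * 3 := by gcongr
    _ = 49 * (3 * x ^ 2) := by ring

theorem sq_le_dyadicPotential_of_ge {x y : ℝ} (hx : 1 / 4 ≤ x) (hy0 : 0 ≤ y)
    (hy : y * (4 * x) ≤ 2) : y ^ 2 ≤ 49 * (dyadicPotential (2 * x) - dyadicPotential x) := by
  have hx0 : 0 < x := by linarith
  rw [dyadicPotential_sub, mul_div_assoc', le_div_iff₀ (by positivity)]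
  have h1 : (2 * (y * x)) ^ 2 ≤ 1 := by
    have : 0 ≤ y * x := by positivity
    apply pow_le_one₀ <;> nlinarith
  have h2 : 1 ≤ 16 * x ^ 2 := by nlinarith
  have h3 : (1 + 4 * x ^ 2) * (1 + x ^ 2) ≤ (20 * x ^ 2) * (17 * x ^ 2) := by
    gcongr <;> linarith
  calc y ^ 2 * ((1 + 4 * x ^ 2) * (1 + x ^ 2)) ≤ y ^ 2 * ((20 * x ^ 2) * (17 * x ^ 2)) := by gcongr
    _ = (2 * (y * x)) ^ 2 * (85 * x ^ 2) := by ring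
    _ ≤ 1 * (85 * x ^ 2) := by gcongr
    _ ≤ 49 * (3 * x ^ 2) := by nlinarith

/-- A decreasing family of frequency sets, given near each point by the dyadic distance of the
`i`-th coordinate to a point of `Q⁻¹ℤ`. -/
def IsNested (i : Fin 2) (Q : ℕ) (U : ℕ → Set Plane) : Prop :=
  (∀ n, MeasurableSet (U n)) ∧
    ∀ ξ, (∀ n, ξ ∉ U n) ∨ ∃ a : ℤ, ∀ n, ξ ∈ U n ↔ |ξ i - a / Q| < ((2 : ℝ) ^ (n + 1))⁻¹

theorem IsNested.antitone {i : Fin 2} {Q : ℕ} {U : ℕ → Set Plane} (h : IsNested i Q U) :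
    Antitone U := by
  intro m n hmn ξ hξ
  rcases h.2 ξ with h0 | ⟨a, ha⟩
  · exact absurd hξ (h0 n)
  · rw [ha] at hξ ⊢
    refine hξ.trans_le ?_
    gcongr
    norm_num

/-- Translation by `Q` along an axis gives a symbol of period `1/Q`, so `ξ i` may be measured from
any point `a / Q`. This is where the grid hypothesis acts. -/
theorem avgSymbol_single_eq (i : Fin 2) {Q : ℕ} (hQ : 0 < Q) (m : ℕ) (ξ : Plane) (a : ℤ) :
    avgSymbol (EuclideanSpace.single i (Q : ℝ)) m ξ = ((2 ^ m : ℕ) : ℂ)⁻¹ *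
      ∑ k ∈ Finset.range (2 ^ m),
        Complex.exp (2 * Real.pi * (Q * (ξ i - a / Q) : ℝ) * Complex.I) ^ k := by
  unfold avgSymbol
  push_cast
  congr 1
  refine Finset.sum_congr rfl fun k _ => ?_
  have hQ' : (Q : ℂ) ≠ 0 := by exact_mod_cast hQ.ne'
  rw [charSymbol, Real.fourierChar_apply, ← Complex.exp_nat_mul, Complex.exp_eq_exp_iff_exists_int]
  refine ⟨k * a, ?_⟩
  have : inner ℝ (k • EuclideanSpace.single i (Q : ℝ)) ξ = k * (Q * ξ i) := by
    rw [← Nat.cast_smul_eq_nsmul ℝ, inner_smul_left, EuclideanSpace.inner_single_left]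
    simp
  rw [this]
  push_cast
  field_simp
  ring

/-- Square function bound for the difference of the sharp cutoffs and the orbit averages. -/
theorem tensorBound_ind_sub_avg {i : Fin 2} {Q : ℕ} {U : ℕ → Set Plane} (h : IsNested i Q U)
    {L : ℕ} (hQ : 0 < Q) (hL : Q ≤ 2 ^ L) (hL' : 2 ^ L ≤ 2 * Q) :
    TensorBound (fun m ξ => ind (U (L + m)) ξ -
      avgSymbol (EuclideanSpace.single i (Q : ℝ)) m ξ * ind (U L) ξ) 7 := by
  refine tensorBound_of_tsum_sq_le (fun m => (isSymbol_ind (h.1 _)).sub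
    ((isSymbol_avgSymbol _ _).mul (isSymbol_ind (h.1 _)))) fun ξ => ?_
  by_cases hξL : ξ ∉ U L
  · have : ∀ m, ξ ∉ U (L + m) := fun m hm => hξL (h.antitone (Nat.le_add_right _ _) hm)
    simp [ind_of_notMem hξL, fun m => ind_of_notMem (this m)]
  push Not at hξL
  rcases h.2 ξ with h0 | ⟨a, ha⟩
  · exact absurd hξL (h0 L)
  set θ : ℝ := Q * (ξ i - a / Q) with hθ_def
  set z := Complex.exp (2 * Real.pi * θ * Complex.I) with hz_def
  have hz : ‖z‖ = 1 := by
    rw [hz_def, show (2 * Real.pi * θ * Complex.I : ℂ) = ((2 * Real.pi * θ : ℝ) : ℂ) * Complex.I by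
      push_cast; ring]
    exact Complex.norm_exp_ofReal_mul_I _
  have hQr : (0 : ℝ) < Q := by exact_mod_cast hQ
  have hLr : (Q : ℝ) ≤ 2 ^ L := by exact_mod_cast hL
  have hLr' : (2 : ℝ) ^ L ≤ 2 * Q := by exact_mod_cast hL'
  have hθ : |θ| = Q * |ξ i - a / Q| := by rw [hθ_def, abs_mul, abs_of_pos hQr]
  have hmem : ∀ m, ξ ∈ U (L + m) ↔ |ξ i - a / Q| * (2 ^ L * (2 ^ m * 2)) < 1 := by
    intro m
    rw [ha, ← one_div, lt_div_iff₀ (by positivity), pow_succ, pow_add, mul_assoc]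
  -- `Q ≤ 2 ^ L` gives smallness inside the cutoff, and `2 ^ L ≤ 2 * Q` gives largeness outside it,
  -- so the cutoff sits where the Dirichlet kernel changes from near one to decaying.
  have hsmall : ∀ m, ξ ∈ U (L + m) → 2 ^ m * |θ| ≤ 1 / 2 := by
    intro m hm
    rw [hmem] at hm
    rw [hθ]
    have : (Q : ℝ) * (|ξ i - a / Q| * 2 ^ m) ≤ 2 ^ L * (|ξ i - a / Q| * 2 ^ m) := by gcongr
    linarith
  have hlarge : ∀ m, ξ ∉ U (L + m) → 1 / 4 ≤ 2 ^ m * |θ| := by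
    intro m hm
    rw [hmem, not_lt] at hm
    rw [hθ]
    have : 2 ^ L * (|ξ i - a / Q| * 2 ^ m) ≤ 2 * Q * (|ξ i - a / Q| * 2 ^ m) := by gcongr
    linarith
  have hθhalf : |θ| ≤ 1 / 2 := by simpa using hsmall 0 hξL
  set d : ℕ → ℂ := fun m => ind (U (L + m)) ξ -
    avgSymbol (EuclideanSpace.single i (Q : ℝ)) m ξ * ind (U L) ξ
  have hd : ∀ m, ‖d m‖ ^ 2 ≤
      49 * (dyadicPotential (2 ^ (m + 1) * |θ|) - dyadicPotential (2 ^ m * |θ|)) := by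
    intro m
    have hpos : (0 : ℝ) ≤ 2 ^ m * |θ| := by positivity
    simp only [d]
    rw [ind_of_mem hξL, mul_one, avgSymbol_single_eq i hQ m ξ a, pow_succ' (2 : ℝ) m,
      mul_assoc (2 : ℝ) (2 ^ m) |θ|]
    by_cases hm : ξ ∈ U (L + m)
    · rw [ind_of_mem hm, norm_sub_rev]
      refine sq_le_dyadicPotential_of_le hpos (hsmall m hm) (norm_nonneg _) ?_
      refine (norm_avg_pow_sub_one_le hz (by positivity)).trans ?_
      have := norm_exp_two_pi_sub_one_le θ
      push_cast
      calc (2 : ℝ) ^ m * ‖z - 1‖ ≤ 2 ^ m * (7 * |θ|) := by gcongr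
        _ = 7 * (2 ^ m * |θ|) := by ring
    · rw [ind_of_notMem hm, zero_sub, norm_neg]
      refine sq_le_dyadicPotential_of_ge (hlarge m hm) (norm_nonneg _) ?_
      refine le_trans ?_ (norm_avg_pow_mul_le hz (2 ^ m))
      have := le_norm_exp_two_pi_sub_one hθhalf
      refine mul_le_mul_of_nonneg_left ?_ (norm_nonneg _)
      push_cast
      calc 4 * ((2 : ℝ) ^ m * |θ|) = 2 ^ m * (4 * |θ|) := by ring
        _ ≤ 2 ^ m * ‖z - 1‖ := by gcongr
  -- The bounds in `hd` telescope, and the potential takes values in `[0, 1]`.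
  have hpart : ∀ M, ∑ m ∈ Finset.range M, ‖d m‖ ^ 2 ≤ 49 := by
    intro M
    refine (Finset.sum_le_sum fun m _ => hd m).trans ?_
    rw [← Finset.mul_sum, Finset.sum_range_sub fun m => dyadicPotential (2 ^ m * |θ|)]
    have h1 : dyadicPotential (2 ^ M * |θ|) ≤ 1 := by
      unfold dyadicPotential
      exact div_le_one_of_le₀ (by linarith) (by positivity)
    have h2 : 0 ≤ dyadicPotential (2 ^ 0 * |θ|) := by
      unfold dyadicPotential
      positivity
    linarith
  refine ENNReal.tsum_le_of_sum_range_le fun M => ?_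
  have e : ∀ m, ‖d m‖ₑ ^ 2 = ENNReal.ofReal (‖d m‖ ^ 2) := by
    intro m
    rw [← ofReal_norm, ENNReal.ofReal_pow (norm_nonneg _)]
  calc ∑ m ∈ Finset.range M, ‖d m‖ₑ ^ 2
      = ENNReal.ofReal (∑ m ∈ Finset.range M, ‖d m‖ ^ 2) := by
        simp_rw [e]
        rw [ENNReal.ofReal_sum_of_nonneg fun m _ => by positivity]
    _ ≤ ENNReal.ofReal 49 := ENNReal.ofReal_le_ofReal (hpart M)
    _ = 7 ^ 2 := by norm_num

/-- The tensor bound for the sharp cutoffs of a nested family. -/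
theorem IsNested.tensorBound {i : Fin 2} {Q : ℕ} {U : ℕ → Set Plane} (h : IsNested i Q U)
    {L T : ℕ} (hQ : 0 < Q) (hL : Q ≤ 2 ^ L) (hL' : 2 ^ L ≤ 2 * Q) (hLT : L < 2 ^ T) :
    TensorBound (fun n => ind (U n)) (T + 26) := by
  have h1 := tensorBound_ind_min h.1 h.antitone hLT
  have h2 := (tensorBound_ind_sub_avg h hQ hL hL').comp fun n => n - L
  have h3 := ((tensorBound_avgSymbol (EuclideanSpace.single i (Q : ℝ))).mul_right
    (measurable_ind (h.1 L)) (norm_ind_le _)).comp fun n => n - L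
  have h4 := tensorBound_const (r := fun ξ => -ind (U L) ξ) (measurable_ind (h.1 L)).fun_neg
    fun ξ => by rw [norm_neg]; exact norm_ind_le _ _
  -- With `m = n - L` truncated at zero, the four terms sum to `ind (U n)` on both sides of `L`: for
  -- `n ≤ L` the last three cancel, for `n ≥ L` the first and last do. The constants are `T + 1`, 7,
  -- 17 and 1.
  have h5 := ((h1.add h2).add h3).add h4
  convert h5 using 1
  · funext n ξ
    rcases le_total n L with hn | hn
    · rw [min_eq_left hn, Nat.sub_eq_zero_of_le hn, add_zero]
      ring
    · rw [min_eq_right hn, Nat.add_sub_cancel' hn]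
      ring
  · ring_nf

/-! ### Separated rectangles and factorisation of the symbol -/

theorem mem_rect {l ξ : Plane} {n₁ n₂ : ℕ} : ξ ∈ rect l n₁ n₂ ↔
    |ξ 0 - l 0| < ((2 : ℝ) ^ (n₁ + 1))⁻¹ ∧ |ξ 1 - l 1| < ((2 : ℝ) ^ (n₂ + 1))⁻¹ := by
  rw [abs_lt, abs_lt]
  rfl

theorem rect_anti (l : Plane) {m₁ m₂ n₁ n₂ : ℕ} (h₁ : m₁ ≤ n₁) (h₂ : m₂ ≤ n₂) :
    rect l n₁ n₂ ⊆ rect l m₁ m₂ := by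
  intro ξ hξ
  rw [mem_rect] at hξ ⊢
  have key : ∀ {m n : ℕ}, m ≤ n → ((2 : ℝ) ^ (n + 1))⁻¹ ≤ (2 ^ (m + 1))⁻¹ := by
    intro m n h
    gcongr
    norm_num
  exact ⟨hξ.1.trans_le (key h₁), hξ.2.trans_le (key h₂)⟩

/-- All these rectangles lie in open unit squares, and two such squares that meet have centres less
than one apart in the max norm. -/
theorem Separated.eq_of_mem_rect {Lam : Finset Plane} (hsep : Separated Lam) {l l' ξ : Plane}
    (hl : l ∈ Lam) (hl' : l' ∈ Lam) {n₁ n₂ n₁' n₂' : ℕ} (h : ξ ∈ rect l n₁ n₂)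
    (h' : ξ ∈ rect l' n₁' n₂') : l = l' := by
  have h := mem_rect.1 (rect_anti l (Nat.zero_le _) (Nat.zero_le _) h)
  have h' := mem_rect.1 (rect_anti l' (Nat.zero_le _) (Nat.zero_le _) h')
  norm_num at h h'
  by_contra hne
  have key : ∀ i : Fin 2, |ξ i - l i| < 1 / 2 → |ξ i - l' i| < 1 / 2 → |l i - l' i| < 1 := by
    intro i h1 h2
    have := abs_sub_le (l i) (ξ i) (l' i)
    rw [abs_sub_comm (l i) (ξ i)] at this
    linarith
  rcases le_max_iff.1 (hsep l hl l' hl' hne) with h0 | h0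
  · exact absurd (key 0 h.1 h'.1) (not_lt.2 h0)
  · exact absurd (key 1 h.2 h'.2) (not_lt.2 h0)

/-- The union of the rectangles of a given size around the points of `Λ`. -/
def rectUnion (Lam : Finset Plane) (n₁ n₂ : ℕ) : Set Plane := ⋃ l ∈ Lam, rect l n₁ n₂

theorem mem_rectUnion {Lam : Finset Plane} {n₁ n₂ : ℕ} {ξ : Plane} :
    ξ ∈ rectUnion Lam n₁ n₂ ↔ ∃ l ∈ Lam, ξ ∈ rect l n₁ n₂ := by
  simp [rectUnion]

theorem measurableSet_rectUnion (Lam : Finset Plane) (n₁ n₂ : ℕ) :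
    MeasurableSet (rectUnion Lam n₁ n₂) :=
  Finset.measurableSet_biUnion _ fun l _ => measurableSet_rect l n₁ n₂

theorem Separated.mem_rectUnion_iff {Lam : Finset Plane} (hsep : Separated Lam) {l ξ : Plane}
    (hl : l ∈ Lam) (h : ξ ∈ rect l 0 0) {n₁ n₂ : ℕ} :
    ξ ∈ rectUnion Lam n₁ n₂ ↔ ξ ∈ rect l n₁ n₂ := by
  rw [mem_rectUnion]
  refine ⟨?_, fun h' => ⟨l, hl, h'⟩⟩
  rintro ⟨l', hl', h'⟩
  rwa [hsep.eq_of_mem_rect hl hl' h h']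

theorem isNested_rectUnion_left {Q₁ Q₂ : ℕ} {Lam : Finset Plane} (hgrid : InGrid Q₁ Q₂ Lam)
    (hsep : Separated Lam) : IsNested 0 Q₁ fun n => rectUnion Lam n 0 := by
  refine ⟨fun n => measurableSet_rectUnion _ _ _, fun ξ => ?_⟩
  by_cases hex : ∃ l ∈ Lam, ξ ∈ rect l 0 0
  · obtain ⟨l, hl, hξ⟩ := hex
    obtain ⟨a, b, ha, hb⟩ := hgrid l hl
    refine Or.inr ⟨a, fun n => ?_⟩
    rw [hsep.mem_rectUnion_iff hl hξ, mem_rect, ← ha]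
    exact and_iff_left (mem_rect.1 hξ).2
  · refine Or.inl fun n hn => hex ?_
    obtain ⟨l, hl, h⟩ := mem_rectUnion.1 hn
    exact ⟨l, hl, rect_anti l (Nat.zero_le _) le_rfl h⟩

theorem isNested_rectUnion_right {Q₁ Q₂ : ℕ} {Lam : Finset Plane} (hgrid : InGrid Q₁ Q₂ Lam)
    (hsep : Separated Lam) : IsNested 1 Q₂ fun n => rectUnion Lam 0 n := by
  refine ⟨fun n => measurableSet_rectUnion _ _ _, fun ξ => ?_⟩
  by_cases hex : ∃ l ∈ Lam, ξ ∈ rect l 0 0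
  · obtain ⟨l, hl, hξ⟩ := hex
    obtain ⟨a, b, ha, hb⟩ := hgrid l hl
    refine Or.inr ⟨b, fun n => ?_⟩
    rw [hsep.mem_rectUnion_iff hl hξ, mem_rect, ← hb]
    exact and_iff_right (mem_rect.1 hξ).1
  · refine Or.inl fun n hn => hex ?_
    obtain ⟨l, hl, h⟩ := mem_rectUnion.1 hn
    exact ⟨l, hl, rect_anti l le_rfl (Nat.zero_le _) h⟩

/-- At most one `l` contributes at `ξ`, and for that `l` the two coordinate conditions are
independent; this separates the two parameters. -/
theorem Separated.sum_ind_rect {Lam : Finset Plane} (hsep : Separated Lam) (n₁ n₂ : ℕ)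
    (ξ : Plane) : ∑ l ∈ Lam, ind (rect l n₁ n₂) ξ =
      ind (rectUnion Lam n₁ 0) ξ * ind (rectUnion Lam 0 n₂) ξ := by
  by_cases hex : ∃ l ∈ Lam, ξ ∈ rect l 0 0
  · obtain ⟨l, hl, hξ⟩ := hex
    rw [Finset.sum_eq_single_of_mem l hl]
    · have h0 := mem_rect.1 hξ
      have h1 : ξ ∈ rectUnion Lam n₁ 0 ↔ |ξ 0 - l 0| < ((2 : ℝ) ^ (n₁ + 1))⁻¹ := by
        rw [hsep.mem_rectUnion_iff hl hξ, mem_rect]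
        exact and_iff_left h0.2
      have h2 : ξ ∈ rectUnion Lam 0 n₂ ↔ |ξ 1 - l 1| < ((2 : ℝ) ^ (n₂ + 1))⁻¹ := by
        rw [hsep.mem_rectUnion_iff hl hξ, mem_rect]
        exact and_iff_right h0.1
      have h3 : ξ ∈ rect l n₁ n₂ ↔ ξ ∈ rectUnion Lam n₁ 0 ∧ ξ ∈ rectUnion Lam 0 n₂ := by
        rw [h1, h2, mem_rect]
      by_cases c1 : ξ ∈ rectUnion Lam n₁ 0 <;> by_cases c2 : ξ ∈ rectUnion Lam 0 n₂ <;>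
        simp [ind, Set.indicator, h3, c1, c2]
    · intro l' hl' hne
      refine ind_of_notMem fun h => hne ?_
      exact hsep.eq_of_mem_rect hl' hl h hξ
  · have h : ∀ m₁ m₂, ∀ l ∈ Lam, ξ ∉ rect l m₁ m₂ := fun m₁ m₂ l hl h =>
      hex ⟨l, hl, rect_anti l (Nat.zero_le _) (Nat.zero_le _) h⟩
    rw [Finset.sum_eq_zero fun l hl => ind_of_notMem (h _ _ l hl), ind_of_notMem, zero_mul]
    rw [mem_rectUnion]
    rintro ⟨l, hl, h'⟩
    exact h _ _ l hl h'

theorem cutoff_eq_mulL2 {S : Set Plane} (hS : MeasurableSet S) (g : L2) :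
    cutoff hS g = mulL2 (ind S) g := by
  apply Lp.ext
  have hc : cutoff hS g =ᵐ[volume] S.indicator g := MemLp.coeFn_toLp _
  filter_upwards [coeFn_mulL2 (isSymbol_ind hS) g, hc] with ξ h1 h2
  rw [h1, h2]
  by_cases h : ξ ∈ S
  · rw [ind_of_mem h, one_mul, Set.indicator_of_mem h]
  · rw [ind_of_notMem h, zero_mul, Set.indicator_of_notMem h]

theorem Separated.freqProj_eq {Lam : Finset Plane} (hsep : Separated Lam) (n₁ n₂ : ℕ) (f : L2) :
    freqProj Lam n₁ n₂ f =
      fourierMul (fun ξ => ind (rectUnion Lam n₁ 0) ξ * ind (rectUnion Lam 0 n₂) ξ) f := by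
  simp_rw [← hsep.sum_ind_rect]
  rw [fourierMul_sum_symbol _ fun l => isSymbol_ind (measurableSet_rect l n₁ n₂), freqProj]
  simp_rw [cutoff_eq_mulL2]
  rfl

/-! ### Counting levels by iterated logarithms -/

theorem exists_pow_two_mem {n : ℕ} (hn : 0 < n) : ∃ L, n ≤ 2 ^ L ∧ 2 ^ L ≤ 2 * n := by
  refine ⟨Nat.clog 2 n, Nat.le_pow_clog (by norm_num) n, ?_⟩
  rcases Nat.eq_or_lt_of_le (Nat.succ_le_of_lt hn) with h | h
  · simp [← h]
  · have h1 := Nat.pow_pred_clog_lt_self (b := 2) (by norm_num) h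
    have h2 : 0 < Nat.clog 2 n := Nat.clog_pos (by norm_num) h
    have h3 : 2 ^ Nat.clog 2 n = 2 * 2 ^ (Nat.clog 2 n).pred := by
      rw [← pow_succ', Nat.pred_eq_sub_one, Nat.sub_add_cancel h2]
    omega

/-- Doubly logarithmic control of the number of dyadic levels needed for denominator `Q`. -/
theorem exists_levels {Q : ℕ} (hQ : 0 < Q) : ∃ L T : ℕ, Q ≤ 2 ^ L ∧ 2 ^ L ≤ 2 * Q ∧ L < 2 ^ T ∧
    ∀ x : ℝ, (Q : ℝ) ≤ x → (T : ℝ) + 26 ≤ 32 * max 1 (Real.log (Real.log x)) := by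
  obtain ⟨L, hL, hL'⟩ := exists_pow_two_mem hQ
  obtain ⟨T, hT, hT'⟩ := exists_pow_two_mem (Nat.succ_pos L)
  refine ⟨L, T, hL, hL', hT, fun x hx => ?_⟩
  have hQ1 : (1 : ℝ) ≤ Q := by exact_mod_cast hQ
  have hlog2 : 1 / 2 ≤ Real.log 2 := by linarith [Real.log_two_gt_d9]
  have hlogx : 0 ≤ Real.log x := Real.log_nonneg (hQ1.trans hx)
  have hLx : (L : ℝ) ≤ 1 + 2 * Real.log x := by
    have h1 : (2 : ℝ) ^ L ≤ 2 * x := by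
      have : (2 : ℝ) ^ L ≤ 2 * Q := by exact_mod_cast hL'
      linarith
    have h2 := Real.log_le_log (by positivity) h1
    rw [Real.log_pow, Real.log_mul (by norm_num) (by linarith)] at h2
    have h3 : ((L : ℝ) - 1) * Real.log 2 ≤ Real.log x := by linarith
    rcases le_total ((L : ℝ) - 1) 0 with h4 | h4
    · linarith
    · nlinarith
  have hTx : (2 : ℝ) ^ T ≤ 4 + 4 * Real.log x := by
    have : (2 : ℝ) ^ T ≤ 2 * (L + 1) := by exact_mod_cast hT'
    linarith
  -- The split at `log x = e` is where the iterated logarithm reaches one. The conclusion follows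
  -- from `30 + 2 * M ≤ 32 * M` for `M ≥ 1`.
  have hmain : (T : ℝ) ≤ 4 + 2 * max 1 (Real.log (Real.log x)) := by
    rcases le_total (Real.log x) (Real.exp 1) with h | h
    · have h1 : (2 : ℝ) ^ T < 2 ^ 4 := by
        have := Real.exp_one_lt_d9
        linarith
      have h2 : T < 4 := (pow_lt_pow_iff_right₀ (by norm_num)).1 h1
      have h3 : (T : ℝ) < 4 := by exact_mod_cast h2
      linarith [le_max_left 1 (Real.log (Real.log x))]
    · have he : 1 < Real.exp 1 := by linarith [Real.exp_one_gt_d9]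
      have hy : 1 < Real.log x := he.trans_le h
      have h1 : (2 : ℝ) ^ T ≤ 2 ^ 3 * Real.log x := by linarith
      have h2 := Real.log_le_log (by positivity) h1
      rw [Real.log_mul (by norm_num) (by linarith), Real.log_pow, Real.log_pow] at h2
      have h3 : ((T : ℝ) - 3) * Real.log 2 ≤ Real.log (Real.log x) := by
        push_cast at h2
        linarith
      have h4 : 0 ≤ Real.log (Real.log x) := Real.log_nonneg hy.le
      have h5 := le_max_right 1 (Real.log (Real.log x))
      rcases le_total ((T : ℝ) - 3) 0 with h6 | h6
      · linarith
      · nlinarith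
  linarith [le_max_left 1 (Real.log (Real.log x))]

theorem eLpNorm_maximalFn_le_of_le {Q₁ Q₂ : ℕ} (hQ₁ : 0 < Q₁) (hQ₂ : 0 < Q₂) {Lam : Finset Plane}
    (hgrid : InGrid Q₁ Q₂ Lam) (hsep : Separated Lam) {x₁ x₂ : ℝ} (hx₁ : Q₁ ≤ x₁) (hx₂ : Q₂ ≤ x₂)
    (f : L2) : eLpNorm (maximalFn Lam f) 2 volume ≤
      ENNReal.ofReal (1024 * max 1 (Real.log (Real.log x₁)) * max 1 (Real.log (Real.log x₂))) *
        eLpNorm f 2 volume := by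
  obtain ⟨L₁, T₁, h1, h2, h3, h4⟩ := exists_levels hQ₁
  obtain ⟨L₂, T₂, k1, k2, k3, k4⟩ := exists_levels hQ₂
  have hA := (isNested_rectUnion_left hgrid hsep).tensorBound hQ₁ h1 h2 h3
  have hB := (isNested_rectUnion_right hgrid hsep).tensorBound hQ₂ k1 k2 k3
  -- The second coordinate's family serves as the arbitrary second family in the tensor bound of the
  -- first.
  have hmax := hA.2 _ _ hB.1 hB.maxBound f
  simp_rw [← hsep.freqProj_eq] at hmax
  refine hmax.trans ?_
  gcongr
  have e : ∀ T : ℕ, (T + 26 : ℝ≥0∞) = ENNReal.ofReal (T + 26) := by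
    intro T
    rw [ENNReal.ofReal_add (by positivity) (by positivity)]
    simp
  rw [e, e, ← ENNReal.ofReal_mul (by positivity)]
  refine ENNReal.ofReal_le_ofReal ?_
  calc ((T₁ : ℝ) + 26) * (T₂ + 26)
      ≤ (32 * max 1 (Real.log (Real.log x₁))) * (32 * max 1 (Real.log (Real.log x₂))) := by
        gcongr
        exacts [h4 _ hx₁, k4 _ hx₂]
    _ = _ := by ring

theorem le_mul_sqrt_card (Q : ℕ) {Lam : Finset Plane} (h : Lam.Nonempty) :
    (Q : ℝ) ≤ Q * √(Lam.card : ℝ) := by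
  refine le_mul_of_one_le_right (Nat.cast_nonneg _) ?_
  rw [Real.one_le_sqrt]
  exact_mod_cast h.card_pos

theorem eLpNorm_maximalFn_le {Q₁ Q₂ : ℕ} (hQ₁ : 0 < Q₁) (hQ₂ : 0 < Q₂) {Lam : Finset Plane}
    (hgrid : InGrid Q₁ Q₂ Lam) (hsep : Separated Lam) (f : L2) :
    eLpNorm (maximalFn Lam f) 2 volume ≤
      ENNReal.ofReal (1024 * max 1 (Real.log (Real.log (Q₁ * √(Lam.card : ℝ))))
        * max 1 (Real.log (Real.log (Q₂ * √(Lam.card : ℝ))))) * eLpNorm f 2 volume := by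
  rcases Lam.eq_empty_or_nonempty with rfl | hne
  -- For empty `Λ` the argument of the logarithm is `0`, and `Real.log 0 = 0 = Real.log 1`, so both
  -- maxima equal one and `x₁ = x₂ = 1` gives the same constant.
  · have := eLpNorm_maximalFn_le_of_le one_pos one_pos (Lam := ∅) (fun l hl => by simp at hl) hsep
      (x₁ := 1) (x₂ := 1) (by simp) (by simp) f
    simpa using this
  · exact eLpNorm_maximalFn_le_of_le hQ₁ hQ₂ hgrid hsep (le_mul_sqrt_card Q₁ hne)
      (le_mul_sqrt_card Q₂ hne) f

/-- `Q ^ 2 * N` is an integer exceeding `e ^ 2 > 7`, hence at least 8. -/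
theorem sqrt_eight_le {Q N : ℕ} (h : Real.exp 1 < Q * √(N : ℝ)) : √8 ≤ Q * √(N : ℝ) := by
  have hpos : (0 : ℝ) ≤ Q * √(N : ℝ) := by positivity
  have h1 : (7 : ℝ) < (Q * √(N : ℝ)) ^ 2 := by nlinarith [Real.exp_one_gt_d9]
  rw [mul_pow, Real.sq_sqrt (Nat.cast_nonneg _)] at h1
  have h2 : 7 < Q ^ 2 * N := by exact_mod_cast h1
  have h3 : (8 : ℝ) ≤ (Q : ℝ) ^ 2 * N := by exact_mod_cast h2
  rw [Real.sqrt_le_left hpos, mul_pow, Real.sq_sqrt (Nat.cast_nonneg _)]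
  exact h3

theorem one_lt_log_sqrt_eight : 1 < Real.log √8 := by
  rw [Real.lt_log_iff_exp_lt (by positivity), Real.lt_sqrt (Real.exp_pos 1).le]
  nlinarith [Real.exp_one_lt_d9, Real.exp_pos 1]

/-- The iterated logarithm could approach zero as its argument decreases to `e`; integrality keeps
the argument at least `√8 > e`, so a uniform positive lower bound lets a constant absorb the maximum
with one. -/
theorem exists_max_one_loglog_le : ∃ K : ℝ, 1 ≤ K ∧ ∀ Q N : ℕ, Real.exp 1 < Q * √(N : ℝ) →
    max 1 (Real.log (Real.log (Q * √(N : ℝ)))) ≤ K * Real.log (Real.log (Q * √(N : ℝ))) := by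
  set c := Real.log (Real.log √8)
  have hc : 0 < c := Real.log_pos one_lt_log_sqrt_eight
  refine ⟨1 + c⁻¹, by linarith [inv_pos.2 hc], fun Q N h => ?_⟩
  set y := Real.log (Real.log (Q * √(N : ℝ)))
  have hy : c ≤ y := Real.log_le_log (by linarith [one_lt_log_sqrt_eight])
    (Real.log_le_log (by positivity) (sqrt_eight_le h))
  have h1 : 1 ≤ c⁻¹ * y := by
    rw [inv_mul_eq_div, one_le_div hc]
    exact hy
  rw [add_mul, one_mul]
  exact max_le (by linarith) (by linarith)

end TwoParam

/-! ### The main theorem -/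

theorem theorem1 :
    ∃ C : ℝ, 0 < C ∧
      ∀ Q₁ Q₂ : ℕ, 0 < Q₁ → 0 < Q₂ →
      ∀ Lam : Finset TwoParam.Plane, TwoParam.InGrid Q₁ Q₂ Lam → TwoParam.Separated Lam →
      ∀ f : TwoParam.L2,
        -- the bound `C loglog(Q₁√|Λ|) loglog(Q₂√|Λ|)`, where both iterated logarithms are positive
        (Real.exp 1 < Q₁ * √(Lam.card : ℝ) → Real.exp 1 < Q₂ * √(Lam.card : ℝ) →
          eLpNorm (TwoParam.maximalFn Lam f) 2 volume ≤
            ENNReal.ofReal (C * Real.log (Real.log (Q₁ * √(Lam.card : ℝ)))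
              * Real.log (Real.log (Q₂ * √(Lam.card : ℝ)))) * eLpNorm f 2 volume) ∧
        -- the bound for every `Λ`, each iterated logarithm being replaced by one if it is
        -- smaller than one or undefined
        eLpNorm (TwoParam.maximalFn Lam f) 2 volume ≤
          ENNReal.ofReal (C * max 1 (Real.log (Real.log (Q₁ * √(Lam.card : ℝ))))
            * max 1 (Real.log (Real.log (Q₂ * √(Lam.card : ℝ))))) * eLpNorm f 2 volume := by

  obtain ⟨K, hK, hKle⟩ := TwoParam.exists_max_one_loglog_le
  refine ⟨1024 * K ^ 2, by positivity, fun Q₁ Q₂ hQ₁ hQ₂ Lam hgrid hsep f => ⟨fun h₁ h₂ => ?_, ?_⟩⟩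
  · refine (TwoParam.eLpNorm_maximalFn_le hQ₁ hQ₂ hgrid hsep f).trans ?_
    gcongr ENNReal.ofReal ?_ * _
    set y₁ := Real.log (Real.log (Q₁ * √(Lam.card : ℝ)))
    set y₂ := Real.log (Real.log (Q₂ * √(Lam.card : ℝ)))
    calc 1024 * max 1 y₁ * max 1 y₂ = 1024 * (max 1 y₁ * max 1 y₂) := by ring
      _ ≤ 1024 * ((K * y₁) * (K * y₂)) := by
        have p₁ : 0 ≤ max 1 y₁ := zero_le_one.trans (le_max_left _ _)
        have p₂ : 0 ≤ max 1 y₂ := zero_le_one.trans (le_max_left _ _)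
        have q₁ := hKle Q₁ _ h₁
        have q₂ := hKle Q₂ _ h₂
        exact mul_le_mul_of_nonneg_left (mul_le_mul q₁ q₂ p₂ (p₁.trans q₁)) (by norm_num)
      _ = 1024 * K ^ 2 * y₁ * y₂ := by ring
  · refine (TwoParam.eLpNorm_maximalFn_le hQ₁ hQ₂ hgrid hsep f).trans ?_
    gcongr ENNReal.ofReal (?_ * _ * _) * _
    nlinarith
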